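/- Let $n,p\ge 0$, let $X\in\mathbb{R}^{n\times p}$ have rows $x_i^\top$, let $y\in\{0,1\}^n$ and $\zeta>0$, and let $\pi_{\rm loc},\pi_{\rm glo}$ be probability densities on $(0,\infty)$. Consider the regularized sparse logistic regression model in which, independently, $y_i\mid\beta\sim\mathrm{Bernoulli}\big(1/(1+e^{-x_i^\top\beta})\big)$, $z_j\mid\beta_j\sim N(\beta_j,\zeta^2)$ with observed value $z_j=0$, $\beta_j\mid\tau,\lambda_j\sim N(0,\tau^2\lambda_j^2)$, $\tau\sim\pi_{\rm glo}$ and $\lambda_j\sim\pi_{\rm loc}$. One cycle of the Pólya-Gamma Gibbs sampler started from $(\beta^*,\lambda^*)\in\mathbb{R}^p\times(0,\infty)^p$ draws 1. $\tau\mid\beta^*,\lambda^*$ from the density on $(0,\infty)$ proportional to $\pi_{\rm glo}(\tau)\prod_{j}\frac{1}{\tau\lambda_j^*}\exp\!\big(-\frac{(\beta_j^*)^2}{2\tau^2(\lambda_j^*)^2}\big)$; 2. independently for each $j$, $\lambda_j\mid\beta_j^*,\tau$ from the density on $(0,\infty)$ proportional to $\frac{1}{\tau\lambda_j}\exp\!\big(-\frac{(\beta_j^*)^2}{2\tau^2\lambda_j^2}\big)\pi_{\rm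 loc}(\lambda_j)$; 3. independently for each $i$, $\omega_i\mid\beta^*\sim\mathrm{PolyaGamma}(1,x_i^\top\beta^*)$, where $\mathrm{PolyaGamma}(1,c)$ is the law of $\frac{1}{2\pi^2}\sum_{k\ge1}\frac{g_k}{(k-1/2)^2+c^2/(4\pi^2)}$ with $g_k$ independent standard exponential variables; 4. $\beta\mid\omega,\tau,\lambda\sim N\big(\Phi^{-1}X^\top(y-\tfrac12),\,\Phi^{-1}\big)$, where $\Phi=X^\top\mathrm{diag}(\omega)X+\zeta^{-2}I+\tau^{-2}\mathrm{diag}(\lambda_1^{-2},\dots,\lambda_p^{-2})$. Let $P(\beta,\lambda\mid\beta^*,\lambda^*)$ be the marginal transition density obtained by integrating out $\tau$ and $\omega$. (If some $\beta_j^*=0$ and the density in step 2 is not normalizable, that conditional density is taken to be $0$.) Assume $\|\pi_{\rm loc}\|_\infty<\infty$ and that $\pi_{\rm glo}$ is supported on $[\tau_{\min},\infty)$ for some $\tau_{\min}>0$. Then, for every $0\le\alpha<1$, the kernel satisfies a drift condition with the Lyapunov function $V(\beta)=\sum_{j=1}^p|\beta_j|^{-\alpha}\in[0,\infty]$ (with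 $0^{-\alpha}=\infty$ for $\alpha>0$ and $0^{0}=1$): there are constants $0\le\gamma<1$ and $0\le b<\infty$ such that $$\int_{\mathbb{R}^p\times(0,\infty)^p}V(\beta)\,P(\beta,\lambda\mid\beta^*,\lambda^*)\,d\beta\,d\lambda\;\le\;\gamma\,V(\beta^*)+b\qquad\text{for all }(\beta^*,\lambda^*)\in\mathbb{R}^p\times(0,\infty)^p.$$ -/

import Mathlib

open MeasureTheory ProbabilityTheory Set
open scoped ENNReal NNReal Matrix

noncomputable section

namespace SparseLogit

/-- A (proper) prior density for a scale parameter, i.e. a probability density on `(0, ∞)`.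
Only the values of `f` on `(0, ∞)` are ever used. -/
structure IsScaleDensity (f : ℝ → ℝ≥0) : Prop where
  measurable : Measurable f
  lintegral_eq_one : ∫⁻ x in Ioi 0, (f x : ℝ≥0∞) = 1

/-- The series `(1 / (2 π²)) ∑_{k ≥ 1} g_k / ((k - 1/2)² + c² / (4 π²))` (the terms being indexed
from `k = 0` here), as a function of the sequence `g`. The terms are nonnegative for the sequences
of interest; the sum is taken in `[0, ∞]` and then read as a real number. -/
def polyaGammaSeries (c : ℝ) (g : ℕ → ℝ) : ℝ :=
  (1 / (2 * Real.pi ^ 2)) *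
    (∑' k : ℕ, ENNReal.ofReal
      (g k / (((k : ℝ) + 1 / 2) ^ 2 + c ^ 2 / (4 * Real.pi ^ 2)))).toReal

/-- The Pólya-Gamma distribution with shape `1` and tilting parameter `c`: the law of
`(1 / (2 π²)) ∑_{k ≥ 1} g_k / ((k - 1/2)² + c² / (4 π²))` for independent standard exponential
variables `g_k`. -/
def polyaGamma (c : ℝ) : Measure ℝ :=
  (Measure.infinitePi fun _ : ℕ => expMeasure 1).map (polyaGammaSeries c)

theorem measurable_polyaGammaSeries (c : ℝ) : Measurable (polyaGammaSeries c) := by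
  unfold polyaGammaSeries
  refine Measurable.const_mul (Measurable.ennreal_toReal (Measurable.tsum fun k => ?_)) _
  exact ((measurable_pi_apply k).div_const _).ennreal_ofReal

instance isProbabilityMeasure_polyaGamma (c : ℝ) : IsProbabilityMeasure (polyaGamma c) := by
  have : ∀ _ : ℕ, IsProbabilityMeasure (expMeasure 1) :=
    fun _ => isProbabilityMeasure_expMeasure one_pos
  exact Measure.isProbabilityMeasure_map (measurable_polyaGammaSeries c).aemeasurable

/-- The Lebesgue density at `x` of the Gaussian distribution `N(m, Φ⁻¹)` on `ℝ^p` with mean `m`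
and (positive definite) precision matrix `Φ`. -/
def gaussianDensity {p : ℕ} (m : Fin p → ℝ) (Φ : Matrix (Fin p) (Fin p) ℝ) (x : Fin p → ℝ) :
    ℝ≥0∞ :=
  ENNReal.ofReal (√(Φ.det / (2 * Real.pi) ^ p) *
    Real.exp (-(1 / 2) * ((x - m) ⬝ᵥ (Φ *ᵥ (x - m)))))

/-- The precision matrix `Φ = Xᵀ Ω X + ζ⁻² I + τ⁻² Λ⁻²` of `β` given `ω, τ, λ`, with
`Ω = diag ω` and `Λ = diag λ`. -/
def precision {n p : ℕ} (X : Matrix (Fin n) (Fin p) ℝ) (ζ : ℝ)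
    (ω : Fin n → ℝ) (τ : ℝ) (l : Fin p → ℝ) : Matrix (Fin p) (Fin p) ℝ :=
  Xᵀ * Matrix.diagonal ω * X + (ζ ^ 2)⁻¹ • (1 : Matrix (Fin p) (Fin p) ℝ)
    + (τ ^ 2)⁻¹ • Matrix.diagonal fun j => ((l j) ^ 2)⁻¹

/-- The density of the full conditional
`β | ω, τ, λ, y, X, z = 0 ∼ N(Φ⁻¹ Xᵀ (y - 1/2), Φ⁻¹)`. -/
def coefDensity {n p : ℕ} (X : Matrix (Fin n) (Fin p) ℝ) (y : Fin n → ℝ) (ζ : ℝ)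
    (ω : Fin n → ℝ) (τ : ℝ) (l β : Fin p → ℝ) : ℝ≥0∞ :=
  gaussianDensity ((precision X ζ ω τ l)⁻¹ *ᵥ (Xᵀ *ᵥ fun i => y i - 1 / 2))
    (precision X ζ ω τ l) β

/-- The kernel density `P(β | β*, τ, λ)`: draw independent
`ω_i | β* ∼ PolyaGamma(1, x_iᵀ β*)`, then `β | ω, τ, λ`. -/
def coefKernel {n p : ℕ} (X : Matrix (Fin n) (Fin p) ℝ) (y : Fin n → ℝ) (ζ : ℝ)
    (βs : Fin p → ℝ) (τ : ℝ) (l β : Fin p → ℝ) : ℝ≥0∞ :=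
  ∫⁻ ω, coefDensity X y ζ ω τ l β ∂(Measure.pi fun i => polyaGamma ((X *ᵥ βs) i))

/-- The factor `(τ λ)⁻¹ exp(- b² / (2 τ² λ²))` contributed by a coefficient `b ∼ N(0, τ² λ²)` to
the joint density of the scale parameters. -/
def scaleFactor (b τ l : ℝ) : ℝ≥0∞ :=
  ENNReal.ofReal ((τ * l)⁻¹ * Real.exp (-(b ^ 2) / (2 * τ ^ 2 * l ^ 2)))

/-- The conditional density `π(λ_j | β_j, τ)` of a local scale on `(0, ∞)` at the point `l`,
for `b = β_j`. -/
def localDensity (πloc : ℝ → ℝ≥0) (b τ l : ℝ) : ℝ≥0∞ :=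
  (Ioi (0 : ℝ)).indicator
    (fun l => scaleFactor b τ l * πloc l / ∫⁻ u in Ioi 0, scaleFactor b τ u * πloc u) l

/-- The conditional density `π(τ | β, λ)` of the global scale on `(0, ∞)`. The factors
`π_loc(λ_j)` do not depend on `τ` and cancel. -/
def globalDensity {p : ℕ} (πglo : ℝ → ℝ≥0) (β l : Fin p → ℝ) (τ : ℝ) : ℝ≥0∞ :=
  (Ioi (0 : ℝ)).indicator
    (fun τ => (πglo τ * ∏ j, scaleFactor (β j) τ (l j)) /
      ∫⁻ t in Ioi 0, πglo t * ∏ j, scaleFactor (β j) t (l j)) τ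

/-- The density at `θ = (β, λ)` of the marginal transition kernel `P(β, λ | β*, λ*)` of the
Pólya-Gamma Gibbs sampler started from `θs = (β*, λ*)`: draw `τ | β*, λ*`, then independent
`λ_j | β*_j, τ`, then `ω | β*`, then `β | ω, τ, λ`, and integrate out `τ` and `ω`. -/
def marginalKernel {n p : ℕ} (X : Matrix (Fin n) (Fin p) ℝ) (y : Fin n → ℝ) (ζ : ℝ)
    (πloc πglo : ℝ → ℝ≥0) (θs θ : (Fin p → ℝ) × (Fin p → ℝ)) : ℝ≥0∞ :=
  ∫⁻ τ in Ioi 0, coefKernel X y ζ θs.1 τ θ.2 θ.1 *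
    (∏ j, localDensity πloc (θs.1 j) τ (θ.2 j)) * globalDensity πglo θs.1 θs.2 τ

/-- The function `V(β) = ∑_j |β_j|^{-α}` with values in `[0, ∞]` (for `α > 0` it is `∞` when some
coordinate vanishes). -/
def lyapunov {p : ℕ} (α : ℝ) (β : Fin p → ℝ) : ℝ≥0∞ :=
  ∑ j, ENNReal.ofReal |β j| ^ (-α)

/-- The drift condition for the transition density `P θs θ` (with respect to `μ`) on the state
space `S`: for some `γ < 1` and `b < ∞`, `(P V)(θs) ≤ γ V(θs) + b` for all states `θs`. -/
def DriftCondition {Θ : Type*} [MeasurableSpace Θ] (μ : Measure Θ) (S : Set Θ)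
    (P : Θ → Θ → ℝ≥0∞) (V : Θ → ℝ≥0∞) : Prop :=
  ∃ γ b : ℝ≥0, γ < 1 ∧ ∀ θs ∈ S, ∫⁻ θ in S, V θ * P θs θ ∂μ ≤ γ * V θs + b

end SparseLogit

end

/-!
The expected value of `V` after one cycle is estimated by integrating out `β`, then `ω`, then the
local scales, then `τ`, one coordinate `|β j| ^ (-α)` at a time. All integrals are taken in
`[0, ∞]`, so Tonelli's theorem applies without integrability conditions, and a quotient
`f / ∫ f` has total mass at most one whatever the value of `∫ f`.

*Coefficients.* Under `N(m, Φ⁻¹)` the conditional law of `β j` given the other coordinates is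
Gaussian with precision exactly `Φ j j`. A Gaussian weight of precision `a` has absolute moment of
order `-α` at most `C a ^ (α / 2)` uniformly in its centre, because its density is at most of order
`a ^ (1 / 2)`. Hence `E |β j| ^ (-α) ≤ C (Φ j j) ^ (α / 2)` without any information on `m` or `Φ⁻¹`
(`lintegral_rpow_neg_mul_gaussianDensity_le`). As
`Φ j j = ∑ i, ω i * X i j ^ 2 + ζ⁻² + τ⁻² λ_j⁻²` and the Pólya-Gamma means are bounded uniformly
in the tilting parameter (`exists_lintegral_polyaGamma_le`), averaging over `ω` leaves
`C (B + (τ λ_j) ^ (-α))` (`exists_lintegral_coefKernel_le`).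

*Local scales.* With `s = |β*_j| / τ`, the law of `λ_j` has density proportional to
`l⁻¹ exp (-s² / (2 l²)) π_loc(l)`. The mean of `l ^ (-α)` is at most `ε s ^ (-α) + K` for every
`ε > 0` (`exists_lintegral_rpow_neg_mul_le`). Near `s = 0` it is `o(s ^ (-α))`, by an argument that
depends on whether `∫ l⁻¹ π_loc(l) dl` is finite
(`exists_lintegral_rpow_neg_mul_le_near_zero`); larger values of `s` are reduced to this case, as
the mean decreases in `s` (`lintegral_rpow_neg_mul_le_of_le`). Multiplying by `τ ^ (-α)` turns the
bound into `ε |β*_j| ^ (-α) + K τ ^ (-α)`, and `τ ≥ τmin` bounds the last term. A choice of `ε` with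
`C ε = 1 / 2` gives the drift condition with `γ = 1 / 2`.
-/

namespace SparseLogit

/-! ### Negative moments of Gaussian densities -/

theorem lintegral_Ioo_zero_rpow_neg {α δ : ℝ} (hα1 : α < 1) (hδ : 0 < δ) :
    ∫⁻ x in Ioo 0 δ, ENNReal.ofReal |x| ^ (-α) = ENNReal.ofReal (δ ^ (1 - α) / (1 - α)) := by
  have hint : IntegrableOn (fun x : ℝ => x ^ (-α)) (Ioo 0 δ) :=
    ((intervalIntegrable_iff_integrableOn_Ioo_of_le hδ.le).1
      (intervalIntegral.intervalIntegrable_rpow' (by linarith)))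
  have h1 : ∫ x in Ioo 0 δ, x ^ (-α) = δ ^ (1 - α) / (1 - α) := by
    rw [← integral_Ioc_eq_integral_Ioo, ← intervalIntegral.integral_of_le hδ.le,
      integral_rpow (Or.inl (by linarith))]
    rw [Real.zero_rpow (by linarith)]
    ring_nf
  rw [← h1, ofReal_integral_eq_lintegral_ofReal hint]
  · refine setLIntegral_congr_fun measurableSet_Ioo fun x hx => ?_
    rw [abs_of_pos hx.1, ENNReal.ofReal_rpow_of_pos hx.1]
  · exact (ae_restrict_iff' measurableSet_Ioo).2
      (ae_of_all _ fun x hx => Real.rpow_nonneg hx.1.le _)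

theorem lintegral_Ioo_rpow_neg_le {α δ : ℝ} (hα1 : α < 1) (hδ : 0 < δ) :
    ∫⁻ x in Ioo (-δ) δ, ENNReal.ofReal |x| ^ (-α)
      ≤ ENNReal.ofReal (2 / (1 - α) * δ ^ (1 - α)) := by
  have hsub : Ioo (-δ) δ ⊆ (Ioo (-δ) 0 ∪ Ioo 0 δ) ∪ {0} := by
    intro x hx
    rcases lt_trichotomy x 0 with h | h | h
    · exact Or.inl (Or.inl ⟨hx.1, h⟩)
    · exact Or.inr h
    · exact Or.inl (Or.inr ⟨h, hx.2⟩)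
  have hneg : ∫⁻ x in Ioo (-δ) 0, ENNReal.ofReal |x| ^ (-α)
      = ∫⁻ x in Ioo 0 δ, ENNReal.ofReal |x| ^ (-α) := by
    have := (Measure.measurePreserving_neg (volume : Measure ℝ)).setLIntegral_comp_preimage
      (s := Ioo 0 δ) (f := fun x => ENNReal.ofReal |x| ^ (-α)) measurableSet_Ioo (by fun_prop)
    rw [← this]
    simp
  calc ∫⁻ x in Ioo (-δ) δ, ENNReal.ofReal |x| ^ (-α)
      ≤ ∫⁻ x in (Ioo (-δ) 0 ∪ Ioo 0 δ) ∪ {0}, ENNReal.ofReal |x| ^ (-α) :=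
        lintegral_mono_set hsub
    _ ≤ ((∫⁻ x in Ioo (-δ) 0, ENNReal.ofReal |x| ^ (-α))
          + ∫⁻ x in Ioo 0 δ, ENNReal.ofReal |x| ^ (-α))
          + ∫⁻ x in {0}, ENNReal.ofReal |x| ^ (-α) :=
        (lintegral_union_le _ _ _).trans (by gcongr; exact lintegral_union_le _ _ _)
    _ = ENNReal.ofReal (2 / (1 - α) * δ ^ (1 - α)) := by
        have : (0 : ℝ) < 1 - α := by linarith
        rw [hneg, setLIntegral_measure_zero {(0 : ℝ)} _ (by simp),
          lintegral_Ioo_zero_rpow_neg hα1 hδ, add_zero, ← ENNReal.ofReal_add (by positivity)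
          (by positivity)]
        congr 1
        ring

theorem lintegral_gaussian_shift {a : ℝ} (ha : 0 < a) (μ : ℝ) :
    ∫⁻ x, ENNReal.ofReal (Real.exp (-(a / 2) * (x - μ) ^ 2))
      = ENNReal.ofReal √(Real.pi / (a / 2)) := by
  rw [lintegral_sub_right_eq_self
    (fun x => ENNReal.ofReal (Real.exp (-(a / 2) * x ^ 2))) μ,
    ← ofReal_integral_eq_lintegral_ofReal (integrable_exp_neg_mul_sq (by positivity))
      (ae_of_all _ fun x => (Real.exp_pos _).le), integral_gaussian]

/-- For a Gaussian weight with precision `a`, the absolute moment of order `-α` is, uniformly in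
the centre, at most of order `a ^ (α / 2)`. The weight is at most `1`, which controls the singular
part `|x| < a ^ (-1 / 2)`; outside, `|x| ^ (-α)` is at most `a ^ (α / 2)`. -/
theorem lintegral_rpow_neg_mul_gaussian_le {α a : ℝ} (hα0 : 0 ≤ α) (hα1 : α < 1) (ha : 0 < a)
    (μ : ℝ) :
    ∫⁻ x, ENNReal.ofReal |x| ^ (-α) * ENNReal.ofReal (Real.exp (-(a / 2) * (x - μ) ^ 2))
      ≤ ENNReal.ofReal (2 / (1 - α) + 1) * ENNReal.ofReal a ^ (α / 2) *
        ∫⁻ x, ENNReal.ofReal (Real.exp (-(a / 2) * (x - μ) ^ 2)) := by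
  set δ : ℝ := (√a)⁻¹ with hδdef
  have hδ : 0 < δ := by positivity
  have h1α : (0 : ℝ) < 1 - α := by linarith
  set g : ℝ → ℝ≥0∞ := fun x => ENNReal.ofReal (Real.exp (-(a / 2) * (x - μ) ^ 2)) with hg
  have hgm : Measurable g := by fun_prop
  have hδα : δ ^ (-α) = a ^ (α / 2) := by
    rw [hδdef, Real.inv_rpow (by positivity), Real.rpow_neg (by positivity), inv_inv,
      Real.sqrt_eq_rpow, ← Real.rpow_mul ha.le]
    ring_nf
  have hpt : ∀ x, ENNReal.ofReal |x| ^ (-α) * g x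
      ≤ (Ioo (-δ) δ).indicator (fun x => ENNReal.ofReal |x| ^ (-α)) x
        + ENNReal.ofReal (a ^ (α / 2)) * g x := by
    intro x
    by_cases hx : x ∈ Ioo (-δ) δ
    · rw [indicator_of_mem hx]
      refine le_add_right ?_
      have : g x ≤ 1 := by
        rw [hg]
        refine ENNReal.ofReal_le_one.2 (Real.exp_le_one_iff.2 ?_)
        have := mul_nonneg ha.le (sq_nonneg (x - μ))
        linarith
      exact (mul_le_mul_right this _).trans (mul_one _).le
    · have hx' : δ ≤ |x| := by
        by_contra h
        exact hx (abs_lt.1 (not_le.1 h))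
      refine le_add_left ?_
      gcongr
      rw [ENNReal.ofReal_rpow_of_pos (hδ.trans_le hx'), ← hδα]
      exact ENNReal.ofReal_le_ofReal (Real.rpow_le_rpow_of_nonpos hδ hx' (by linarith))
  have hδint : ENNReal.ofReal δ ≤ ∫⁻ x, g x := by
    rw [hg, lintegral_gaussian_shift ha]
    refine ENNReal.ofReal_le_ofReal ?_
    rw [hδdef, ← Real.sqrt_inv]
    refine Real.sqrt_le_sqrt ?_
    rw [inv_eq_one_div, div_le_div_iff₀ ha (by positivity)]
    nlinarith [Real.pi_gt_three]
  calc ∫⁻ x, ENNReal.ofReal |x| ^ (-α) * g x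
      ≤ (∫⁻ x in Ioo (-δ) δ, ENNReal.ofReal |x| ^ (-α))
        + ENNReal.ofReal (a ^ (α / 2)) * ∫⁻ x, g x := by
        refine (lintegral_mono hpt).trans ?_
        rw [lintegral_add_right _ (by fun_prop), lintegral_indicator measurableSet_Ioo,
          lintegral_const_mul _ hgm]
    _ ≤ ENNReal.ofReal (2 / (1 - α)) * ENNReal.ofReal (a ^ (α / 2)) * (∫⁻ x, g x)
        + ENNReal.ofReal (a ^ (α / 2)) * ∫⁻ x, g x := by
        gcongr
        refine (lintegral_Ioo_rpow_neg_le hα1 hδ).trans ?_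
        have : 2 / (1 - α) * δ ^ (1 - α) = 2 / (1 - α) * a ^ (α / 2) * δ := by
          rw [← hδα, sub_eq_neg_add, Real.rpow_add_one hδ.ne', mul_assoc]
        rw [this, ENNReal.ofReal_mul (by positivity), ENNReal.ofReal_mul (by positivity)]
        gcongr
    _ = _ := by
        rw [ENNReal.ofReal_add (by positivity) zero_le_one, ENNReal.ofReal_rpow_of_pos ha,
          ENNReal.ofReal_one]
        ring

section Multivariate

variable {p : ℕ}

theorem dotProduct_mulVec_update {Φ : Matrix (Fin p) (Fin p) ℝ} (hΦ : Φ.IsSymm) (j : Fin p)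
    (v : Fin p → ℝ) (t : ℝ) :
    (Function.update v j t) ⬝ᵥ (Φ *ᵥ Function.update v j t)
      = Φ j j * t ^ 2 + 2 * t * (Φ *ᵥ Function.update v j 0) j
        + (Function.update v j 0) ⬝ᵥ (Φ *ᵥ Function.update v j 0) := by
  set v0 := Function.update v j 0 with hv0
  have h : Function.update v j t = v0 + t • Pi.single j (1 : ℝ) := by
    ext i
    by_cases hi : i = j
    · subst hi; simp [hv0]
    · simp [hv0, hi]
  have hs : v0 ⬝ᵥ (Φ *ᵥ Pi.single j 1) = (Φ *ᵥ v0) j := by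
    rw [Matrix.dotProduct_mulVec, ← Matrix.mulVec_transpose, hΦ.eq]
    simp
  have hd : (Pi.single j (1 : ℝ)) ⬝ᵥ (Φ *ᵥ Pi.single j 1) = Φ j j := by simp
  rw [h, Matrix.mulVec_add, Matrix.mulVec_smul, add_dotProduct, dotProduct_add, dotProduct_add,
    dotProduct_smul, smul_dotProduct, smul_dotProduct, dotProduct_smul, hs, hd]
  simp only [single_dotProduct, one_mul, smul_eq_mul]
  ring

theorem continuous_gaussianDensity (m : Fin p → ℝ) (Φ : Matrix (Fin p) (Fin p) ℝ) :
    Continuous (gaussianDensity m Φ) := by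
  unfold gaussianDensity
  refine ENNReal.continuous_ofReal.comp ?_
  simp only [dotProduct, Matrix.mulVec]
  fun_prop

/-- Along the `j`-th coordinate line, a Gaussian density is a multiple of the one-dimensional
Gaussian weight with precision `Φ j j` (complete the square). -/
theorem gaussianDensity_update {m : Fin p → ℝ} {Φ : Matrix (Fin p) (Fin p) ℝ} (hΦ : Φ.PosDef)
    (j : Fin p) (x : Fin p → ℝ) :
    ∃ (c : ℝ≥0∞) (μ : ℝ), ∀ t, gaussianDensity m Φ (Function.update x j t)
      = c * ENNReal.ofReal (Real.exp (-(Φ j j / 2) * (t - μ) ^ 2)) := by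
  have hjj : 0 < Φ j j := hΦ.diag_pos
  have hsym : Φ.IsSymm := by
    simpa [Matrix.IsHermitian, Matrix.IsSymm] using hΦ.isHermitian
  set w : Fin p → ℝ := Function.update (x - m) j 0
  set r : ℝ := (Φ *ᵥ w) j
  refine ⟨ENNReal.ofReal (√(Φ.det / (2 * Real.pi) ^ p) *
    Real.exp (-(1 / 2) * (w ⬝ᵥ (Φ *ᵥ w) - r ^ 2 / Φ j j))), m j - r / Φ j j, fun t => ?_⟩
  have hu : Function.update x j t - m = Function.update (x - m) j (t - m j) := by
    ext i
    by_cases hi : i = j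
    · subst hi; simp
    · simp [hi]
  rw [gaussianDensity, hu, dotProduct_mulVec_update hsym, ← ENNReal.ofReal_mul (by positivity),
    mul_assoc √_, ← Real.exp_add]
  change ENNReal.ofReal (_ * Real.exp (-(1 / 2) * (_ + 2 * (t - m j) * r + _))) = _
  congr 3
  field_simp
  ring

/-- The moment of order `-α` of the `j`-th coordinate is controlled by the `j`-th diagonal entry of
the precision matrix, because that entry is the precision of the conditional law of the `j`-th
coordinate given the others. -/
theorem lintegral_rpow_neg_mul_gaussianDensity_le {α : ℝ} (hα0 : 0 ≤ α) (hα1 : α < 1)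
    (m : Fin p → ℝ) {Φ : Matrix (Fin p) (Fin p) ℝ} (hΦ : Φ.PosDef) (j : Fin p) :
    ∫⁻ x, ENNReal.ofReal |x j| ^ (-α) * gaussianDensity m Φ x
      ≤ ENNReal.ofReal (2 / (1 - α) + 1) * ENNReal.ofReal (Φ j j) ^ (α / 2) *
        ∫⁻ x, gaussianDensity m Φ x := by
  have hm := (continuous_gaussianDensity m Φ).measurable
  rw [← lintegral_const_mul _ hm]
  refine lintegral_le_of_lmarginal_le {j} ?_ (hm.const_mul _) fun x => ?_
  · exact (Measurable.pow_const (by fun_prop) _).mul hm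
  rw [lmarginal_singleton, lmarginal_singleton]
  obtain ⟨c, μ, hc⟩ := gaussianDensity_update (m := m) hΦ j x
  simp only [hc, Function.update_self]
  simp only [mul_left_comm _ c]
  rw [lintegral_const_mul _ (by fun_prop), lintegral_const_mul _ (by fun_prop),
    lintegral_const_mul _ (by fun_prop)]
  gcongr
  exact lintegral_rpow_neg_mul_gaussian_le hα0 hα1 hΦ.diag_pos μ

/-- Tonelli's theorem for a product of functions of single coordinates. -/
theorem lintegral_pi_prod {f : Fin p → ℝ → ℝ≥0∞} (hf : ∀ i, Measurable (f i)) :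
    ∫⁻ x : Fin p → ℝ, ∏ i, f i (x i) = ∏ i, ∫⁻ t, f i t := by
  have key : ∀ s : Finset (Fin p), (∫⋯∫⁻_s, (fun x => ∏ i, f i (x i)) ∂fun _ => volume)
      = fun x => (∏ i ∈ s, ∫⁻ t, f i t) * ∏ i ∈ sᶜ, f i (x i) := by
    intro s
    induction s using Finset.induction with
    | empty => simp
    | insert a s ha ih =>
      have hm : Measurable fun x : Fin p → ℝ => ∏ i, f i (x i) :=
        Finset.measurable_prod _ fun i _ => (hf i).comp (measurable_pi_apply i)
      funext x
      rw [lmarginal_insert _ hm ha, ih]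
      simp only
      have h : ∀ t, ∏ i ∈ sᶜ, f i (Function.update x a t i)
          = f a t * ∏ i ∈ (insert a s)ᶜ, f i (x i) := by
        intro t
        have : sᶜ = insert a (insert a s)ᶜ := by
          ext i; by_cases hi : i = a <;> simp [hi, ha]
        rw [this, Finset.prod_insert (by simp), Function.update_self]
        congr 1
        refine Finset.prod_congr rfl fun i hi => ?_
        rw [Function.update_of_ne]
        rintro rfl
        simp at hi
      simp only [h]
      rw [lintegral_const_mul _ (by fun_prop), lintegral_mul_const _ (hf a),
        Finset.prod_insert ha]
      ring
  have := congr_fun (key Finset.univ) 0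
  rw [← lintegral_eq_lmarginal_univ] at this
  simpa [volume_pi] using this

open scoped MatrixOrder Matrix.Norms.L2Operator in
theorem lintegral_gaussianDensity_le_one (m : Fin p → ℝ) {Φ : Matrix (Fin p) (Fin p) ℝ}
    (hΦ : Φ.PosDef) : ∫⁻ x, gaussianDensity m Φ x ≤ 1 := by
  have hpi := Real.pi_pos
  obtain ⟨B, hΦB⟩ := CStarAlgebra.nonneg_iff_eq_star_mul_self.mp hΦ.posSemidef.nonneg
  replace hΦB : Φ = Bᵀ * B := by
    rw [hΦB, Matrix.star_eq_conjTranspose, Matrix.conjTranspose_eq_transpose_of_trivial]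
  have h1 : Φ.det = B.det ^ 2 := by rw [hΦB, Matrix.det_mul, Matrix.det_transpose, pow_two]
  have hdet : B.det ≠ 0 := by
    intro h
    have := hΦ.det_pos
    simp [h1, h] at this
  set h : (Fin p → ℝ) → ℝ≥0∞ :=
    fun x => ∏ i, ENNReal.ofReal (Real.exp (-(1 / 2) * (x i - 0) ^ 2)) with hh
  have hhm : Measurable h := by fun_prop
  have hq : ∀ x, gaussianDensity m Φ x
      = ENNReal.ofReal √(Φ.det / (2 * Real.pi) ^ p) * h (Matrix.toLin' B (x - m)) := by
    intro x
    simp only [hh]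
    rw [gaussianDensity, ← ENNReal.ofReal_prod_of_nonneg (fun _ _ => (Real.exp_pos _).le),
      ← Real.exp_sum, ← ENNReal.ofReal_mul (by positivity)]
    congr 3
    rw [← Finset.mul_sum, hΦB, ← Matrix.mulVec_mulVec, Matrix.dotProduct_mulVec,
      Matrix.vecMul_transpose]
    simp [dotProduct, pow_two]
  have hint : ∫⁻ x, h x = ENNReal.ofReal (√(2 * Real.pi) ^ p) := by
    rw [lintegral_pi_prod (f := fun _ t => ENNReal.ofReal (Real.exp (-(1 / 2) * (t - 0) ^ 2)))
      (fun i => by fun_prop), lintegral_gaussian_shift one_pos 0, Finset.prod_const,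
      Finset.card_univ, Fintype.card_fin,
      ENNReal.ofReal_pow (by positivity)]
    congr 3
    ring
  have hBm : Measurable (Matrix.toLin' B) :=
    (LinearMap.continuous_of_finiteDimensional _).measurable
  simp only [hq]
  rw [lintegral_const_mul (f := fun x => h (Matrix.toLin' B (x - m))) _
      (hhm.comp (hBm.comp (measurable_id.sub_const m))),
    lintegral_sub_right_eq_self (fun x => h (Matrix.toLin' B x)) m,
    ← lintegral_map hhm hBm, Real.map_matrix_volume_pi_eq_smul_volume_pi hdet,
    lintegral_smul_measure, hint, smul_eq_mul, ← ENNReal.ofReal_mul (by positivity),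
    ← ENNReal.ofReal_mul (by positivity)]
  refine ENNReal.ofReal_le_one.2 (le_of_eq ?_)
  have h2 : √((2 * Real.pi) ^ p) = √(2 * Real.pi) ^ p := by
    rw [← Real.sqrt_sq (by positivity : 0 ≤ √(2 * Real.pi) ^ p), ← pow_mul, mul_comm p 2, pow_mul,
      Real.sq_sqrt (by positivity)]
  rw [h1, Real.sqrt_div (sq_nonneg _), Real.sqrt_sq_eq_abs, h2, abs_inv]
  have h3 : |B.det| ≠ 0 := abs_ne_zero.2 hdet
  have h4 : √(2 * Real.pi) ^ p ≠ 0 := by positivity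
  field_simp

end Multivariate

/-! ### Measurability of the conditional densities -/

section MatrixMeasurability

variable {A p : Type*} [MeasurableSpace A] [Fintype p] [DecidableEq p] {Φ : A → Matrix p p ℝ}

theorem measurable_det_of_entries (hΦ : ∀ i j, Measurable fun a => Φ a i j) :
    Measurable fun a => (Φ a).det := by
  simp only [Matrix.det_apply]
  fun_prop

theorem measurable_inv_of_entries (hΦ : ∀ i j, Measurable fun a => Φ a i j) (i j : p) :
    Measurable fun a => (Φ a)⁻¹ i j := by
  simp only [Matrix.inv_def, Matrix.smul_apply, Matrix.adjugate_apply, Ring.inverse_eq_inv',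
    smul_eq_mul]
  refine (measurable_det_of_entries hΦ).inv.mul (measurable_det_of_entries fun k l => ?_)
  by_cases hk : k = j
  · subst hk; simp
  · simpa [hk] using hΦ k l

omit [DecidableEq p] in
theorem measurable_mulVec_of_entries (hΦ : ∀ i j, Measurable fun a => Φ a i j) {v : A → p → ℝ}
    (hv : Measurable v) : Measurable fun a => Φ a *ᵥ v a := by
  refine measurable_pi_lambda _ fun i => ?_
  simp only [Matrix.mulVec, dotProduct]
  fun_prop

end MatrixMeasurability

section Kernel

variable {n p : ℕ} (X : Matrix (Fin n) (Fin p) ℝ) (y : Fin n → ℝ) (ζ : ℝ)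

theorem precision_apply (ω : Fin n → ℝ) (τ : ℝ) (l : Fin p → ℝ) (i j : Fin p) :
    precision X ζ ω τ l i j = ∑ k, X k i * ω k * X k j
      + (ζ ^ 2)⁻¹ * (1 : Matrix (Fin p) (Fin p) ℝ) i j
      + (τ ^ 2)⁻¹ * if i = j then ((l i) ^ 2)⁻¹ else 0 := by
  simp [precision, Matrix.mul_apply, Matrix.diagonal_apply]

theorem measurable_coefDensity_comp {A : Type*} [MeasurableSpace A] {ω : A → Fin n → ℝ}
    {τ : A → ℝ} {l β : A → Fin p → ℝ} (hω : Measurable ω) (hτ : Measurable τ) (hl : Measurable l)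
    (hβ : Measurable β) : Measurable fun a => coefDensity X y ζ (ω a) (τ a) (l a) (β a) := by
  have hP : ∀ i j, Measurable fun a => precision X ζ (ω a) (τ a) (l a) i j := by
    intro i j
    simp only [precision_apply]
    by_cases h : i = j
    · simp only [h, if_true]
      fun_prop
    · simp only [h, if_false]
      fun_prop
  have hm : Measurable fun a => β a
      - (precision X ζ (ω a) (τ a) (l a))⁻¹ *ᵥ (Xᵀ *ᵥ fun i => y i - 1 / 2) :=
    hβ.sub (measurable_mulVec_of_entries (measurable_inv_of_entries hP) measurable_const)
  have hm' := measurable_mulVec_of_entries hP hm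
  have hdet := measurable_det_of_entries hP
  unfold coefDensity gaussianDensity
  refine Measurable.ennreal_ofReal (Measurable.mul ?_ (Measurable.exp (Measurable.const_mul ?_ _)))
  · exact (hdet.div_const _).sqrt
  · simp only [dotProduct]
    exact Finset.measurable_sum _ fun i _ =>
      ((measurable_pi_apply i).comp hm).mul ((measurable_pi_apply i).comp hm')

theorem measurable_coefKernel_comp (βs : Fin p → ℝ) {A : Type*} [MeasurableSpace A]
    {τ : A → ℝ} {l β : A → Fin p → ℝ} (hτ : Measurable τ) (hl : Measurable l)
    (hβ : Measurable β) : Measurable fun a => coefKernel X y ζ βs (τ a) (l a) (β a) := by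
  unfold coefKernel
  exact Measurable.lintegral_prod_right' (f := fun q : A × (Fin n → ℝ) =>
    coefDensity X y ζ q.2 (τ q.1) (l q.1) (β q.1))
    (measurable_coefDensity_comp X y ζ measurable_snd (hτ.comp measurable_fst)
      (hl.comp measurable_fst) (hβ.comp measurable_fst))

theorem measurable_scaleFactor_comp {A : Type*} [MeasurableSpace A] {b τ l : A → ℝ}
    (hb : Measurable b) (hτ : Measurable τ) (hl : Measurable l) :
    Measurable fun a => scaleFactor (b a) (τ a) (l a) := by
  unfold scaleFactor
  fun_prop

theorem measurable_localDensity_comp {πloc : ℝ → ℝ≥0} (hloc : Measurable πloc) (b : ℝ)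
    {A : Type*} [MeasurableSpace A] {τ l : A → ℝ} (hτ : Measurable τ) (hl : Measurable l) :
    Measurable fun a => localDensity πloc b (τ a) (l a) := by
  have hD : Measurable fun a => ∫⁻ u in Ioi 0, scaleFactor b (τ a) u * πloc u := by
    refine Measurable.lintegral_prod_right' (f := fun q : A × ℝ =>
      scaleFactor b (τ q.1) q.2 * πloc q.2) ?_
    exact (measurable_scaleFactor_comp measurable_const (hτ.comp measurable_fst)
      measurable_snd).mul (by fun_prop)
  have hs := measurable_scaleFactor_comp (measurable_const (a := b)) hτ hl
  have h : (fun a => localDensity πloc b (τ a) (l a)) = {a | 0 < l a}.indicator fun a =>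
      scaleFactor b (τ a) (l a) * πloc (l a) / ∫⁻ u in Ioi 0, scaleFactor b (τ a) u * πloc u := by
    funext a
    by_cases ha : 0 < l a <;> simp [localDensity, ha]
  rw [h]
  exact (Measurable.div (hs.mul (by fun_prop)) hD).indicator (measurableSet_lt measurable_const hl)

theorem measurable_globalDensity {πglo : ℝ → ℝ≥0} (hglo : Measurable πglo) (β l : Fin p → ℝ) :
    Measurable (globalDensity πglo β l) := by
  have hs : ∀ j, Measurable fun τ => scaleFactor (β j) τ (l j) := fun j =>
    measurable_scaleFactor_comp measurable_const measurable_id measurable_const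
  exact Measurable.indicator (by fun_prop) measurableSet_Ioi

/-! ### The Pólya-Gamma distribution -/

theorem lintegral_ofReal_expMeasure_one : ∫⁻ x, ENNReal.ofReal x ∂expMeasure 1 = 1 := by
  have hpdf : ∀ x : ℝ, gammaPDF 1 1 x * ENNReal.ofReal x
      = (Ici (0 : ℝ)).indicator
          (fun x => ENNReal.ofReal (Real.exp (-x) * x ^ ((2 : ℝ) - 1))) x := by
    intro x
    by_cases hx : 0 ≤ x
    · rw [indicator_of_mem (mem_Ici.2 hx), gammaPDF_of_nonneg hx,
        ← ENNReal.ofReal_mul (by positivity)]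
      norm_num
    · simp [gammaPDF_of_neg (not_le.1 hx), hx]
  rw [expMeasure, gammaMeasure, lintegral_withDensity_eq_lintegral_mul _
    (show Measurable (gammaPDF 1 1) from (measurable_gammaPDFReal 1 1).ennreal_ofReal)
    (by fun_prop)]
  simp only [Pi.mul_apply]
  simp only [hpdf]
  rw [lintegral_indicator measurableSet_Ici, setLIntegral_congr Ioi_ae_eq_Ici.symm,
    ← ofReal_integral_eq_lintegral_ofReal (Real.GammaIntegral_convergent (by norm_num)),
    ← Real.Gamma_eq_integral (by norm_num)]
  · norm_num
  · exact (ae_restrict_iff' measurableSet_Ioi).2 (ae_of_all _ fun x hx => by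
      have : (0 : ℝ) < x := hx
      positivity)

theorem polyaGammaSeries_nonneg (c : ℝ) (g : ℕ → ℝ) : 0 ≤ polyaGammaSeries c g := by
  unfold polyaGammaSeries
  positivity

theorem ae_polyaGamma_nonneg (c : ℝ) : ∀ᵐ ω ∂polyaGamma c, 0 ≤ ω := by
  rw [polyaGamma, ae_map_iff (measurable_polyaGammaSeries c).aemeasurable measurableSet_Ici]
  exact ae_of_all _ fun g => polyaGammaSeries_nonneg c g

/-- The means of the distributions `PolyaGamma(1, c)` are bounded in `c`: each term of the series
is largest for `c = 0`. -/
theorem exists_lintegral_polyaGamma_le :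
    ∃ m : ℝ≥0, ∀ c, ∫⁻ ω, ENNReal.ofReal ω ∂polyaGamma c ≤ m := by
  have hsum : Summable fun k : ℕ => 1 / ((k : ℝ) + 1 / 2) ^ 2 := by
    have h := (Real.summable_one_div_nat_add_rpow (1 / 2) 2).2 one_lt_two
    refine h.congr fun k => ?_
    rw [abs_of_nonneg (by positivity)]
    norm_cast
  have hsum' : ∑' k : ℕ, ENNReal.ofReal (1 / ((k : ℝ) + 1 / 2) ^ 2) ≠ ∞ := by
    rw [← ENNReal.ofReal_tsum_of_nonneg (fun k => by positivity) hsum]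
    exact ENNReal.ofReal_ne_top
  refine ⟨(∑' k : ℕ, ENNReal.ofReal (1 / ((k : ℝ) + 1 / 2) ^ 2)).toNNReal, fun c => ?_⟩
  rw [ENNReal.coe_toNNReal hsum']
  have : IsProbabilityMeasure (expMeasure 1) := isProbabilityMeasure_expMeasure one_pos
  have hπ : 1 / (2 * Real.pi ^ 2) ≤ 1 := by
    rw [div_le_one (by positivity)]
    nlinarith [Real.pi_gt_three]
  have hle : ∀ g, ENNReal.ofReal (polyaGammaSeries c g) ≤
      ∑' k : ℕ, ENNReal.ofReal (1 / ((k : ℝ) + 1 / 2) ^ 2) * ENNReal.ofReal (g k) := by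
    intro g
    rw [polyaGammaSeries]
    refine (ENNReal.ofReal_le_ofReal
      (mul_le_of_le_one_left ENNReal.toReal_nonneg hπ)).trans ?_
    refine ENNReal.ofReal_toReal_le.trans (ENNReal.tsum_le_tsum fun k => ?_)
    rw [← ENNReal.ofReal_mul (by positivity)]
    rcases le_total (g k) 0 with h | h
    · rw [ENNReal.ofReal_of_nonpos (div_nonpos_of_nonpos_of_nonneg h (by positivity))]
      exact zero_le
    · refine ENNReal.ofReal_le_ofReal ?_
      rw [one_div_mul_eq_div]
      gcongr
      have : 0 ≤ c ^ 2 / (4 * Real.pi ^ 2) := by positivity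
      linarith
  rw [polyaGamma, lintegral_map (by fun_prop) (measurable_polyaGammaSeries c)]
  refine (lintegral_mono hle).trans ?_
  rw [lintegral_tsum fun k => ((measurable_pi_apply k).ennreal_ofReal.const_mul _).aemeasurable]
  refine ENNReal.tsum_le_tsum fun k => ?_
  have hk := (measurePreserving_eval_infinitePi (fun _ : ℕ => expMeasure 1) k).lintegral_comp
    (f := fun x => ENNReal.ofReal x) (by fun_prop)
  rw [lintegral_ofReal_expMeasure_one] at hk
  rw [lintegral_const_mul _ (measurable_pi_apply k).ennreal_ofReal]
  exact (congrArg _ hk).trans_le (mul_one _).le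

/-! ### Negative moments of the coefficients -/

variable {ζ}

theorem precision_posDef (hζ : 0 < ζ) {ω : Fin n → ℝ} (hω : ∀ i, 0 ≤ ω i) (τ : ℝ)
    (l : Fin p → ℝ) : (precision X ζ ω τ l).PosDef := by
  have h1 : (Xᵀ * Matrix.diagonal ω * X).PosSemidef := by
    have := (Matrix.PosSemidef.diagonal (R := ℝ) hω).conjTranspose_mul_mul_same X
    rwa [Matrix.conjTranspose_eq_transpose_of_trivial] at this
  have h2 : ((ζ ^ 2)⁻¹ • (1 : Matrix (Fin p) (Fin p) ℝ)).PosDef :=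
    Matrix.PosDef.one.smul (by positivity)
  have h3 : ((τ ^ 2)⁻¹ • Matrix.diagonal fun j => ((l j) ^ 2)⁻¹).PosSemidef :=
    (Matrix.PosSemidef.diagonal (R := ℝ) fun j => by positivity).smul (by positivity)
  exact (h2.posSemidef_add h1).add_posSemidef h3

theorem ofReal_precision_diag_rpow_le (hζ : 0 < ζ) {α : ℝ} (hα0 : 0 ≤ α) (hα1 : α < 1)
    {ω : Fin n → ℝ} (hω : ∀ i, 0 ≤ ω i) {τ : ℝ} (hτ : 0 < τ) {l : Fin p → ℝ} {j : Fin p}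
    (hl : 0 < l j) :
    ENNReal.ofReal (precision X ζ ω τ l j j) ^ (α / 2)
      ≤ 1 + ∑ i, ENNReal.ofReal (X i j ^ 2) * ENNReal.ofReal (ω i)
        + ENNReal.ofReal ((ζ ^ 2)⁻¹) ^ (α / 2) + ENNReal.ofReal (τ * l j) ^ (-α) := by
  have hα2 : α / 2 ≤ 1 := by linarith
  have hα2' : 0 ≤ α / 2 := by linarith
  have hsub : ∀ a b c : ℝ≥0∞, (a + b + c) ^ (α / 2) ≤ a ^ (α / 2) + b ^ (α / 2) + c ^ (α / 2) :=
    fun a b c => (ENNReal.rpow_add_le_add_rpow _ _ hα2' hα2).trans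
      (by gcongr; exact ENNReal.rpow_add_le_add_rpow _ _ hα2' hα2)
  have hpos : 0 ≤ ∑ k, X k j * ω k * X k j := Finset.sum_nonneg fun k _ => by
    have := mul_nonneg (sq_nonneg (X k j)) (hω k)
    nlinarith
  rw [precision_apply, if_pos rfl, Matrix.one_apply_eq, mul_one,
    ENNReal.ofReal_add (by positivity) (by positivity), ENNReal.ofReal_add hpos (by positivity)]
  refine (hsub _ _ _).trans ?_
  gcongr
  · rw [ENNReal.ofReal_sum_of_nonneg fun k _ => by
      have := mul_nonneg (sq_nonneg (X k j)) (hω k)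
      nlinarith]
    have : ∀ k, ENNReal.ofReal (X k j * ω k * X k j)
        = ENNReal.ofReal (X k j ^ 2) * ENNReal.ofReal (ω k) := fun k => by
      rw [← ENNReal.ofReal_mul (sq_nonneg _)]
      ring_nf
    simp only [this]
    generalize ∑ i, ENNReal.ofReal (X i j ^ 2) * ENNReal.ofReal (ω i) = a
    rcases le_total a 1 with h | h
    · exact (ENNReal.rpow_le_one h hα2').trans le_self_add
    · calc a ^ (α / 2) ≤ a ^ (1 : ℝ) := ENNReal.rpow_le_rpow_of_exponent_le h hα2
        _ ≤ 1 + a := by rw [ENNReal.rpow_one]; exact le_add_self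
  · have h : (τ ^ 2)⁻¹ * (l j ^ 2)⁻¹ = ((τ * l j) ^ (-1 : ℝ)) ^ (2 : ℝ) := by
      rw [Real.rpow_neg_one, Real.rpow_two]
      field_simp
    rw [h, ← Real.rpow_mul (by positivity), ENNReal.ofReal_rpow_of_pos (by positivity),
      ← Real.rpow_mul (by positivity), ENNReal.ofReal_rpow_of_pos (by positivity)]
    refine ENNReal.ofReal_le_ofReal (le_of_eq ?_)
    congr 1
    ring

/-- Averaging over the Pólya-Gamma variables: given the scales, the moment of order `-α` of `β j`
is bounded by a multiple of a constant plus `(τ λ_j) ^ (-α)`, with neither constant depending on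
the current state. -/
theorem exists_lintegral_coefKernel_le (hζ : 0 < ζ) {α : ℝ} (hα0 : 0 ≤ α) (hα1 : α < 1)
    (j : Fin p) : ∃ B : ℝ≥0, ∀ (βs : Fin p → ℝ) (τ : ℝ) (l : Fin p → ℝ), 0 < τ → 0 < l j →
      ∫⁻ β : Fin p → ℝ, ENNReal.ofReal |β j| ^ (-α) * coefKernel X y ζ βs τ l β
        ≤ ENNReal.ofReal (2 / (1 - α) + 1) * (B + ENNReal.ofReal (τ * l j) ^ (-α)) := by
  obtain ⟨m, hm⟩ := exists_lintegral_polyaGamma_le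
  set S : ℝ≥0∞ := 1 + ∑ i, ENNReal.ofReal (X i j ^ 2) * m + ENNReal.ofReal ((ζ ^ 2)⁻¹) ^ (α / 2)
    with hS
  have hStop : S ≠ ∞ := by
    have h1 : ∑ i, ENNReal.ofReal (X i j ^ 2) * (m : ℝ≥0∞) ≠ ∞ :=
      ENNReal.sum_ne_top.2 fun i _ => ENNReal.mul_ne_top ENNReal.ofReal_ne_top ENNReal.coe_ne_top
    have h2 : ENNReal.ofReal ((ζ ^ 2)⁻¹) ^ (α / 2) ≠ ∞ :=
      ENNReal.rpow_ne_top_of_nonneg (by linarith) ENNReal.ofReal_ne_top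
    exact ENNReal.add_ne_top.2 ⟨ENNReal.add_ne_top.2 ⟨ENNReal.one_ne_top, h1⟩, h2⟩
  refine ⟨S.toNNReal, fun βs τ l hτ hl => ?_⟩
  rw [ENNReal.coe_toNNReal hStop]
  set P := Measure.pi fun i => polyaGamma ((X *ᵥ βs) i)
  have hmeas : Measurable fun q : (Fin p → ℝ) × (Fin n → ℝ) =>
      ENNReal.ofReal |q.1 j| ^ (-α) * coefDensity X y ζ q.2 τ l q.1 :=
    (Measurable.pow_const (by fun_prop) _).mul
      (measurable_coefDensity_comp X y ζ measurable_snd measurable_const measurable_const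
        measurable_fst)
  have hae : ∀ᵐ ω ∂P, ∀ i, 0 ≤ ω i := ae_all_iff.2 fun i =>
    (measurePreserving_eval (fun i => polyaGamma ((X *ᵥ βs) i)) i).quasiMeasurePreserving.ae
      (ae_polyaGamma_nonneg _)
  have hmean : ∀ i, ∫⁻ ω, ENNReal.ofReal (ω i) ∂P ≤ m := fun i => by
    have := (measurePreserving_eval (fun i => polyaGamma ((X *ᵥ βs) i)) i).lintegral_comp
      (f := fun x => ENNReal.ofReal x) (by fun_prop)
    exact this.trans_le (hm _)
  set K := ENNReal.ofReal (2 / (1 - α) + 1)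
  calc ∫⁻ β : Fin p → ℝ, ENNReal.ofReal |β j| ^ (-α) * coefKernel X y ζ βs τ l β
      = ∫⁻ β : Fin p → ℝ, ∫⁻ ω, ENNReal.ofReal |β j| ^ (-α) * coefDensity X y ζ ω τ l β ∂P := by
        refine lintegral_congr fun β => ?_
        rw [coefKernel, lintegral_const_mul]
        exact measurable_coefDensity_comp X y ζ measurable_id measurable_const measurable_const
          measurable_const
    _ = ∫⁻ ω, (∫⁻ β : Fin p → ℝ, ENNReal.ofReal |β j| ^ (-α) * coefDensity X y ζ ω τ l β) ∂P :=
        lintegral_lintegral_swap hmeas.aemeasurable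
    _ ≤ ∫⁻ ω, K * (1 + ∑ i, ENNReal.ofReal (X i j ^ 2) * ENNReal.ofReal (ω i)
        + ENNReal.ofReal ((ζ ^ 2)⁻¹) ^ (α / 2) + ENNReal.ofReal (τ * l j) ^ (-α)) ∂P := by
        refine lintegral_mono_ae (hae.mono fun ω hω => ?_)
        have hΦ := precision_posDef X hζ hω τ l
        calc _ ≤ K * ENNReal.ofReal (precision X ζ ω τ l j j) ^ (α / 2) * 1 :=
              (lintegral_rpow_neg_mul_gaussianDensity_le hα0 hα1 _ hΦ j).trans
                (by gcongr; exact lintegral_gaussianDensity_le_one _ hΦ)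
          _ ≤ _ := by
              rw [mul_one]
              gcongr
              exact ofReal_precision_diag_rpow_le X hζ hα0 hα1 hω hτ hl
    _ ≤ K * (S + ENNReal.ofReal (τ * l j) ^ (-α)) := by
        rw [lintegral_const_mul _ (by fun_prop)]
        gcongr
        rw [lintegral_add_right _ measurable_const, lintegral_add_right _ measurable_const,
          lintegral_add_left measurable_const, lintegral_finsetSum _ (fun i _ => by fun_prop)]
        simp only [lintegral_const, measure_univ, mul_one, hS]
        gcongr with i
        rw [lintegral_const_mul _ (by fun_prop)]
        gcongr
        exact hmean i

end Kernel

/-! ### Negative moments of the local scales -/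

theorem rpow_neg_mul_exp_le {κ s l : ℝ} (hκ0 : 0 ≤ κ) (hκ2 : κ ≤ 2) (hs : 0 < s) (hl : 0 < l) :
    l ^ (-κ) * Real.exp (-(s ^ 2) / (2 * l ^ 2)) ≤ 2 * s ^ (-κ) := by
  have hx : 0 < s / l := by positivity
  have h1 : l ^ (-κ) = s ^ (-κ) * (s / l) ^ κ := by
    rw [Real.div_rpow hs.le hl.le, Real.rpow_neg hs.le, Real.rpow_neg hl.le]
    have : s ^ κ ≠ 0 := (Real.rpow_pos_of_pos hs _).ne'
    field_simp
  have h2 : (s / l) ^ κ ≤ 1 + (s / l) ^ 2 := by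
    rcases le_total (s / l) 1 with h | h
    · have := Real.rpow_le_one hx.le h hκ0
      nlinarith [sq_nonneg (s / l)]
    · have := Real.rpow_le_rpow_of_exponent_le h hκ2
      rw [Real.rpow_two] at this
      linarith
  have h3 : -(s ^ 2) / (2 * l ^ 2) = -((s / l) ^ 2 / 2) := by
    field_simp
  have h4 : (s / l) ^ κ * Real.exp (-((s / l) ^ 2 / 2)) ≤ 2 := by
    have := Real.add_one_le_exp ((s / l) ^ 2 / 2)
    rw [Real.exp_neg, ← div_eq_mul_inv, div_le_iff₀ (Real.exp_pos _)]
    linarith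
  rw [h1, h3, mul_assoc, mul_comm 2]
  exact mul_le_mul_of_nonneg_left h4 (Real.rpow_nonneg hs.le _)

theorem scaleFactor_one (s l : ℝ) :
    scaleFactor s 1 l = ENNReal.ofReal (l⁻¹ * Real.exp (-(s ^ 2) / (2 * l ^ 2))) := by
  simp [scaleFactor]

theorem measurable_scaleFactor_one (s : ℝ) : Measurable (scaleFactor s 1) :=
  measurable_scaleFactor_comp measurable_const measurable_const measurable_id

theorem scaleFactor_one_anti {s t l : ℝ} (hs : 0 < s) (hst : s ≤ t) (hl : 0 < l) :
    scaleFactor t 1 l ≤ scaleFactor s 1 l := by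
  rw [scaleFactor_one, scaleFactor_one]
  gcongr

theorem rpow_neg_mul_scaleFactor_one_le {α s l : ℝ} (hα0 : 0 ≤ α) (hα1 : α < 1) (hs : 0 < s)
    (hl : 0 < l) :
    ENNReal.ofReal l ^ (-α) * scaleFactor s 1 l
      ≤ 2 * ENNReal.ofReal s ^ (-α) * ENNReal.ofReal l⁻¹ := by
  rw [scaleFactor_one, ENNReal.ofReal_rpow_of_pos hl, ENNReal.ofReal_rpow_of_pos hs,
    ← ENNReal.ofReal_mul (by positivity), ← ENNReal.ofReal_ofNat 2,
    ← ENNReal.ofReal_mul (by positivity), ← ENNReal.ofReal_mul (by positivity)]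
  refine ENNReal.ofReal_le_ofReal ?_
  have h := mul_le_mul_of_nonneg_right
    (rpow_neg_mul_exp_le hα0 (by linarith) hs hl) (inv_nonneg.2 hl.le)
  linarith

/-- The integral `∫ l ^ (-α) l⁻¹ exp (-s² / (2 l²)) dl` scales like `s ^ (-α)`: the integrand is at
most `2 s ^ (-1 - α)` for `l ≤ s` and at most `l ^ (-1 - α)` for `l > s`. -/
theorem lintegral_rpow_neg_mul_scaleFactor_one_le {α s : ℝ} (hα0 : 0 < α) (hα1 : α < 1)
    (hs : 0 < s) :
    ∫⁻ l in Ioi 0, ENNReal.ofReal l ^ (-α) * scaleFactor s 1 l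
      ≤ ENNReal.ofReal (2 + 1 / α) * ENNReal.ofReal s ^ (-α) := by
  have hpt : ∀ l ∈ Ioi (0 : ℝ), ENNReal.ofReal l ^ (-α) * scaleFactor s 1 l
      = ENNReal.ofReal (l ^ (-(1 + α)) * Real.exp (-(s ^ 2) / (2 * l ^ 2))) := by
    intro l hl
    have hl : 0 < l := hl
    rw [scaleFactor_one, ENNReal.ofReal_rpow_of_pos hl, ← ENNReal.ofReal_mul (by positivity),
      ← mul_assoc, ← Real.rpow_neg_one l, ← Real.rpow_add hl]
    ring_nf
  have h1 : ∫⁻ l in Ioc 0 s, ENNReal.ofReal l ^ (-α) * scaleFactor s 1 l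
      ≤ ENNReal.ofReal (2 * s ^ (-α)) := by
    calc _ ≤ ∫⁻ l in Ioc 0 s, ENNReal.ofReal (2 * s ^ (-(1 + α))) := by
          refine setLIntegral_mono measurable_const fun l hl => ?_
          rw [hpt l hl.1]
          exact ENNReal.ofReal_le_ofReal
            (rpow_neg_mul_exp_le (by linarith) (by linarith) hs hl.1)
      _ = ENNReal.ofReal (2 * s ^ (-α)) := by
          rw [setLIntegral_const, Real.volume_Ioc, sub_zero, ← ENNReal.ofReal_mul (by positivity)]
          congr 1
          rw [mul_assoc, ← Real.rpow_add_one hs.ne']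
          ring_nf
  have h2 : ∫⁻ l in Ioi s, ENNReal.ofReal l ^ (-α) * scaleFactor s 1 l
      ≤ ENNReal.ofReal (1 / α * s ^ (-α)) := by
    calc _ ≤ ∫⁻ l in Ioi s, ENNReal.ofReal (l ^ (-(1 + α))) := by
          refine setLIntegral_mono (by fun_prop) fun l hl => ?_
          have hl : s < l := hl
          have hl0 : 0 < l := hs.trans hl
          rw [hpt l hl0]
          refine ENNReal.ofReal_le_ofReal (mul_le_of_le_one_right (by positivity) ?_)
          rw [Real.exp_le_one_iff]
          exact div_nonpos_of_nonpos_of_nonneg (by nlinarith [sq_nonneg s]) (by positivity)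
      _ = ENNReal.ofReal (1 / α * s ^ (-α)) := by
          rw [← ofReal_integral_eq_lintegral_ofReal
            (integrableOn_Ioi_rpow_of_lt (by linarith) hs),
            integral_Ioi_rpow_of_lt (by linarith) hs]
          · congr 1
            rw [show -(1 + α) + 1 = -α by ring]
            field_simp
          · exact (ae_restrict_iff' measurableSet_Ioi).2
              (ae_of_all _ fun l hl => Real.rpow_nonneg (hs.trans hl).le _)
  rw [← Ioc_union_Ioi_eq_Ioi hs.le]
  refine (lintegral_union_le _ _ _).trans ((add_le_add h1 h2).trans (le_of_eq ?_))
  rw [ENNReal.ofReal_rpow_of_pos hs, ← ENNReal.ofReal_add (by positivity) (by positivity),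
    ← ENNReal.ofReal_mul (by positivity)]
  ring_nf

variable {πloc : ℝ → ℝ≥0}

theorem lintegral_scaleFactor_one_ne_top (hloc : IsScaleDensity πloc) {s : ℝ} (hs : 0 < s) :
    ∫⁻ l in Ioi 0, scaleFactor s 1 l * πloc l ≠ ∞ := by
  have hπ := hloc.measurable
  have h : ∫⁻ l in Ioi 0, scaleFactor s 1 l * πloc l
      ≤ ∫⁻ l in Ioi 0, ENNReal.ofReal (2 * s ^ (-(1 : ℝ))) * (πloc l : ℝ≥0∞) := by
    refine setLIntegral_mono (by fun_prop) fun l hl => ?_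
    gcongr
    rw [scaleFactor_one, ← Real.rpow_neg_one l]
    exact ENNReal.ofReal_le_ofReal (rpow_neg_mul_exp_le zero_le_one one_le_two hs hl)
  rw [lintegral_const_mul _ (by fun_prop), hloc.lintegral_eq_one, mul_one] at h
  exact ne_top_of_le_ne_top ENNReal.ofReal_ne_top h

theorem lintegral_scaleFactor_one_ne_zero (hloc : IsScaleDensity πloc) (s : ℝ) :
    ∫⁻ l in Ioi 0, scaleFactor s 1 l * πloc l ≠ 0 := by
  have hπ := hloc.measurable
  have hm := measurable_scaleFactor_one s
  intro h
  rw [setLIntegral_eq_zero_iff measurableSet_Ioi (by fun_prop)] at h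
  have h0 : ∫⁻ l in Ioi 0, (πloc l : ℝ≥0∞) = 0 := by
    rw [setLIntegral_eq_zero_iff measurableSet_Ioi (by fun_prop)]
    refine h.mono fun l hl hl0 => ?_
    refine (mul_eq_zero.1 (hl hl0)).resolve_left ?_
    have : 0 < l := hl0
    rw [scaleFactor_one, ENNReal.ofReal_eq_zero, not_le]
    positivity
  rw [hloc.lintegral_eq_one] at h0
  exact one_ne_zero h0

/-- Larger `s` favours larger scales: a bound `c` on the mean of `l ^ (-α)` under the weight
`l⁻¹ exp (-s² / (2 l²)) π(l)` persists when `s` increases. This is Chebyshev's association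
inequality, as `l ^ (-α)` decreases and the ratio `exp (-(s² - s₀²) / (2 l²))` of the weights
increases in `l`. -/
theorem lintegral_rpow_neg_mul_le_of_le (hloc : IsScaleDensity πloc) {α s₀ s c : ℝ} (hα0 : 0 < α)
    (hs₀ : 0 < s₀) (hs : s₀ ≤ s) (hc : 0 < c)
    (h : ∫⁻ l in Ioi 0, ENNReal.ofReal l ^ (-α) * (scaleFactor s₀ 1 l * πloc l)
      ≤ ENNReal.ofReal c * ∫⁻ l in Ioi 0, scaleFactor s₀ 1 l * πloc l) :
    ∫⁻ l in Ioi 0, ENNReal.ofReal l ^ (-α) * (scaleFactor s 1 l * πloc l)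
      ≤ ENNReal.ofReal c * ∫⁻ l in Ioi 0, scaleFactor s 1 l * πloc l := by
  have hπ := hloc.measurable
  have hm := measurable_scaleFactor_one s
  have hm₀ := measurable_scaleFactor_one s₀
  -- `l ^ (-α)` crosses the level `c` at `l = δ`.
  set δ : ℝ := c ^ (-α⁻¹) with hδdef
  have hδ : 0 < δ := Real.rpow_pos_of_pos hc _
  have hδc : δ ^ (-α) = c := by
    rw [hδdef, ← Real.rpow_mul hc.le, neg_mul_neg, inv_mul_cancel₀ hα0.ne', Real.rpow_one]
  set g : ℝ → ℝ := fun l => Real.exp (-(s ^ 2 - s₀ ^ 2) / (2 * l ^ 2)) with hg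
  have hss : 0 ≤ s ^ 2 - s₀ ^ 2 := by nlinarith
  have hgmono : ∀ a b, 0 < a → a ≤ b → g a ≤ g b := by
    intro a b ha hab
    simp only [hg]
    rw [Real.exp_le_exp, neg_div, neg_div, neg_le_neg_iff]
    gcongr
  have hgpos : ∀ a, 0 < g a := fun a => Real.exp_pos _
  have hsf : ∀ l, scaleFactor s 1 l = ENNReal.ofReal (g l) * scaleFactor s₀ 1 l := by
    intro l
    rw [scaleFactor_one, scaleFactor_one, ← ENNReal.ofReal_mul (hgpos l).le, mul_left_comm,
      ← Real.exp_add]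
    congr 3
    ring
  have hpt : ∀ l ∈ Ioi (0 : ℝ), ENNReal.ofReal l ^ (-α) * (scaleFactor s 1 l * πloc l)
      + ENNReal.ofReal (c * g δ) * (scaleFactor s₀ 1 l * πloc l)
      ≤ ENNReal.ofReal (g δ) * (ENNReal.ofReal l ^ (-α) * (scaleFactor s₀ 1 l * πloc l))
        + ENNReal.ofReal c * (scaleFactor s 1 l * πloc l) := by
    intro l hl
    have hl : 0 < l := hl
    have hreal : l ^ (-α) * g l + c * g δ ≤ g δ * l ^ (-α) + c * g l := by
      have : (l ^ (-α) - c) * (g l - g δ) ≤ 0 := by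
        rcases le_total l δ with hld | hld
        · refine mul_nonpos_of_nonneg_of_nonpos ?_ (sub_nonpos.2 (hgmono _ _ hl hld))
          rw [← hδc]
          exact sub_nonneg.2 (Real.rpow_le_rpow_of_nonpos hl hld (by linarith))
        · refine mul_nonpos_of_nonpos_of_nonneg ?_ (sub_nonneg.2 (hgmono _ _ hδ hld))
          rw [← hδc]
          exact sub_nonpos.2 (Real.rpow_le_rpow_of_nonpos hδ hld (by linarith))
      nlinarith
    have hl' : 0 < l ^ (-α) := Real.rpow_pos_of_pos hl _
    have hgl := hgpos l
    have hgδ := hgpos δ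
    have := mul_le_mul_left (ENNReal.ofReal_le_ofReal hreal) (scaleFactor s₀ 1 l * πloc l)
    rw [ENNReal.ofReal_add (by positivity) (by positivity),
      ENNReal.ofReal_add (by positivity) (by positivity), ENNReal.ofReal_mul hl'.le,
      ENNReal.ofReal_mul hgδ.le, ENNReal.ofReal_mul (p := c) (q := g l) hc.le] at this
    rw [hsf, ENNReal.ofReal_rpow_of_pos hl]
    calc _ = _ := by ring
      _ ≤ _ := this
      _ = _ := by ring
  have hint := setLIntegral_mono (μ := volume) (by fun_prop) hpt
  rw [lintegral_add_right _ (by fun_prop), lintegral_add_right _ (by fun_prop),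
    lintegral_const_mul _ (by fun_prop), lintegral_const_mul _ (by fun_prop),
    lintegral_const_mul _ (by fun_prop)] at hint
  have hfin : ENNReal.ofReal (c * g δ) * ∫⁻ l in Ioi 0, scaleFactor s₀ 1 l * πloc l ≠ ∞ :=
    ENNReal.mul_ne_top ENNReal.ofReal_ne_top (lintegral_scaleFactor_one_ne_top hloc hs₀)
  refine (ENNReal.add_le_add_iff_right hfin).1 (hint.trans ?_)
  rw [add_comm]
  refine add_le_add le_rfl ?_
  calc _ ≤ ENNReal.ofReal (g δ) * (ENNReal.ofReal c * ∫⁻ l in Ioi 0, scaleFactor s₀ 1 l * πloc l) :=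
        by gcongr
    _ = _ := by rw [ENNReal.ofReal_mul hc.le]; ring

/-- If `∫ l⁻¹ π(l) dl = ∞`, the normalizing constant of the weight diverges as `s → 0`. -/
theorem exists_lt_lintegral_scaleFactor_one (hloc : IsScaleDensity πloc)
    (hinf : ∫⁻ l in Ioi 0, ENNReal.ofReal l⁻¹ * πloc l = ∞) (B : ℝ≥0) :
    ∃ s : ℝ, 0 < s ∧ (B : ℝ≥0∞) < ∫⁻ l in Ioi 0, scaleFactor s 1 l * πloc l := by
  have hπ := hloc.measurable
  by_contra! hcon
  have hlim : ∀ l : ℝ, Filter.liminf (fun k : ℕ => scaleFactor (1 / ((k : ℝ) + 1)) 1 l * πloc l)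
      Filter.atTop = ENNReal.ofReal l⁻¹ * πloc l := by
    intro l
    refine Filter.Tendsto.liminf_eq (ENNReal.Tendsto.mul_const ?_ (Or.inr ENNReal.coe_ne_top))
    have hc : Continuous fun s => scaleFactor s 1 l := by
      simp only [scaleFactor_one]
      exact ENNReal.continuous_ofReal.comp (by fun_prop)
    have h0 : scaleFactor 0 1 l = ENNReal.ofReal l⁻¹ := by simp [scaleFactor_one]
    rw [← h0]
    exact (hc.tendsto 0).comp tendsto_one_div_add_atTop_nhds_zero_nat
  have hfatou := lintegral_liminf_le (μ := volume.restrict (Ioi (0 : ℝ)))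
    (u := Filter.atTop) (f := fun (k : ℕ) l => scaleFactor (1 / ((k : ℝ) + 1)) 1 l * πloc l)
    (fun k => (measurable_scaleFactor_one _).mul (by fun_prop))
  simp only [hlim, hinf] at hfatou
  have hle : Filter.liminf (fun k : ℕ => ∫⁻ l in Ioi 0,
      scaleFactor (1 / ((k : ℝ) + 1)) 1 l * πloc l) Filter.atTop ≤ (B : ℝ≥0∞) := by
    refine (Filter.liminf_le_liminf (v := fun _ => (B : ℝ≥0∞))
      (Filter.Eventually.of_forall fun k => hcon _ (by positivity))).trans ?_
    simp
  exact ENNReal.coe_ne_top (top_le_iff.1 (hfatou.trans hle))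

/-- Near `s = 0`, the mean of `l ^ (-α)` under the normalized weight is `o(s ^ (-α))`. If
`∫ l⁻¹ π(l) dl = ∞`, the numerator is `O(s ^ (-α))` by boundedness of `π` while the denominator
diverges; otherwise the contribution of `l < δ` to the numerator is at most
`2 s ^ (-α) ∫_{l < δ} l⁻¹ π(l) dl`, which is a small multiple of `s ^ (-α)` for small `δ`. -/
theorem exists_lintegral_rpow_neg_mul_le_near_zero (hloc : IsScaleDensity πloc) {M : ℝ≥0}
    (hM : ∀ l, 0 < l → πloc l ≤ M) {α : ℝ} (hα0 : 0 < α) (hα1 : α < 1) {ε : ℝ} (hε : 0 < ε) :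
    ∃ s₀ K : ℝ, 0 < s₀ ∧ 0 ≤ K ∧ ∀ s, 0 < s → s ≤ s₀ →
      ∫⁻ l in Ioi 0, ENNReal.ofReal l ^ (-α) * (scaleFactor s 1 l * πloc l)
        ≤ ENNReal.ofReal (ε * s ^ (-α) + K) * ∫⁻ l in Ioi 0, scaleFactor s 1 l * πloc l := by
  have hπ := hloc.measurable
  have hanti : ∀ s t, 0 < s → s ≤ t → ∫⁻ l in Ioi 0, scaleFactor t 1 l * πloc l
      ≤ ∫⁻ l in Ioi 0, scaleFactor s 1 l * πloc l := fun s t hs hst =>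
    setLIntegral_mono ((measurable_scaleFactor_one s).mul (by fun_prop)) fun l hl =>
      mul_le_mul_left (scaleFactor_one_anti hs hst hl) _
  by_cases hinf : ∫⁻ l in Ioi 0, ENNReal.ofReal l⁻¹ * πloc l = ∞
  · obtain ⟨s₀, hs₀, hB⟩ := exists_lt_lintegral_scaleFactor_one hloc hinf
      (M * Real.toNNReal (2 + 1 / α) / Real.toNNReal ε)
    refine ⟨s₀, 0, hs₀, le_rfl, fun s hs hss => ?_⟩
    have hsα : 0 < s ^ (-α) := Real.rpow_pos_of_pos hs _
    have hm := measurable_scaleFactor_one s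
    have hB' : (M : ℝ≥0∞) * ENNReal.ofReal (2 + 1 / α)
        ≤ ENNReal.ofReal ε * ∫⁻ l in Ioi 0, scaleFactor s 1 l * πloc l := by
      have h1 : (M : ℝ≥0∞) * ENNReal.ofReal (2 + 1 / α)
          = ENNReal.ofReal ε
            * ((M * Real.toNNReal (2 + 1 / α) / Real.toNNReal ε : ℝ≥0) : ℝ≥0∞) := by
        have hε' : Real.toNNReal ε ≠ 0 := (Real.toNNReal_pos.2 hε).ne'
        rw [ENNReal.ofReal, ENNReal.ofReal, ← ENNReal.coe_mul, ← ENNReal.coe_mul,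
          mul_div_cancel₀ _ hε']
      rw [h1]
      gcongr
      exact hB.le.trans (hanti s s₀ hs hss)
    calc _ ≤ ∫⁻ l in Ioi 0, M * (ENNReal.ofReal l ^ (-α) * scaleFactor s 1 l) := by
          refine setLIntegral_mono (by fun_prop) fun l hl => ?_
          rw [← mul_assoc, mul_comm]
          gcongr
          exact hM l hl
      _ ≤ M * (ENNReal.ofReal (2 + 1 / α) * ENNReal.ofReal s ^ (-α)) := by
          rw [lintegral_const_mul _ (by fun_prop)]
          gcongr
          exact lintegral_rpow_neg_mul_scaleFactor_one_le hα0 hα1 hs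
      _ = (M * ENNReal.ofReal (2 + 1 / α)) * ENNReal.ofReal s ^ (-α) := by ring
      _ ≤ (ENNReal.ofReal ε * ∫⁻ l in Ioi 0, scaleFactor s 1 l * πloc l)
            * ENNReal.ofReal s ^ (-α) := by gcongr
      _ = _ := by
          rw [add_zero, ENNReal.ofReal_mul hε.le, ENNReal.ofReal_rpow_of_pos hs]
          ring
  · have hD := lintegral_scaleFactor_one_ne_zero hloc 1
    set D₁ := ∫⁻ l in Ioi 0, scaleFactor 1 1 l * πloc l with hD₁
    have hε2 : ENNReal.ofReal (ε / 2) * D₁ ≠ 0 := mul_ne_zero (by simpa using hε) hD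
    obtain ⟨η, hη, hηle⟩ := exists_pos_setLIntegral_lt_of_measure_lt hinf hε2
    obtain ⟨δ, hδ, hδη⟩ : ∃ δ : ℝ, 0 < δ ∧ ENNReal.ofReal δ < η := by
      obtain ⟨r, hr0, hr⟩ := ENNReal.lt_iff_exists_nnreal_btwn.1 hη
      exact ⟨r, by simpa using hr0, by simpa using hr⟩
    have hsmall : ∫⁻ l in Ioo 0 δ, ENNReal.ofReal l⁻¹ * πloc l ≤ ENNReal.ofReal (ε / 2) * D₁ := by
      have h := hηle (Ioo 0 δ) (by
        refine (Measure.restrict_apply_le _ _).trans_lt ?_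
        simpa using hδη)
      rw [Measure.restrict_restrict measurableSet_Ioo,
        inter_eq_left.2 (show Ioo 0 δ ⊆ Ioi 0 from fun l hl => hl.1)] at h
      exact h.le
    have hδα : 0 < δ ^ (-α) := Real.rpow_pos_of_pos hδ _
    refine ⟨1, δ ^ (-α), one_pos, hδα.le, fun s hs hs1 => ?_⟩
    have hsα : 0 < s ^ (-α) := Real.rpow_pos_of_pos hs _
    have hm := measurable_scaleFactor_one s
    have hlow : ∫⁻ l in Ioo 0 δ, ENNReal.ofReal l ^ (-α) * (scaleFactor s 1 l * πloc l)
        ≤ ENNReal.ofReal (ε * s ^ (-α)) * ∫⁻ l in Ioi 0, scaleFactor s 1 l * πloc l := by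
      calc _ ≤ ∫⁻ l in Ioo 0 δ, 2 * ENNReal.ofReal s ^ (-α) * (ENNReal.ofReal l⁻¹ * πloc l) := by
            refine setLIntegral_mono (by fun_prop) fun l hl => ?_
            rw [← mul_assoc, ← mul_assoc]
            exact mul_le_mul_left (rpow_neg_mul_scaleFactor_one_le hα0.le hα1 hs hl.1) _
        _ ≤ 2 * ENNReal.ofReal s ^ (-α) * (ENNReal.ofReal (ε / 2)
              * ∫⁻ l in Ioi 0, scaleFactor s 1 l * πloc l) := by
            rw [lintegral_const_mul _ (by fun_prop)]
            gcongr
            exact hsmall.trans (by gcongr; exact hanti s 1 hs hs1)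
        _ = _ := by
            have : ε * s ^ (-α) = 2 * s ^ (-α) * (ε / 2) := by ring
            rw [this, ENNReal.ofReal_mul (by positivity), ENNReal.ofReal_mul (by positivity),
              ENNReal.ofReal_ofNat, ENNReal.ofReal_rpow_of_pos hs]
            ring
    have hhigh : ∫⁻ l in Ici δ, ENNReal.ofReal l ^ (-α) * (scaleFactor s 1 l * πloc l)
        ≤ ENNReal.ofReal (δ ^ (-α)) * ∫⁻ l in Ioi 0, scaleFactor s 1 l * πloc l := by
      calc _ ≤ ∫⁻ l in Ici δ, ENNReal.ofReal (δ ^ (-α)) * (scaleFactor s 1 l * πloc l) := by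
            refine setLIntegral_mono (by fun_prop) fun l hl => ?_
            have hl : δ ≤ l := hl
            gcongr
            rw [ENNReal.ofReal_rpow_of_pos (hδ.trans_le hl)]
            exact ENNReal.ofReal_le_ofReal (Real.rpow_le_rpow_of_nonpos hδ hl (by linarith))
        _ ≤ _ := by
            rw [lintegral_const_mul _ (by fun_prop)]
            gcongr
    rw [← Ioo_union_Ici_eq_Ioi hδ]
    refine (lintegral_union_le _ _ _).trans ?_
    rw [Ioo_union_Ici_eq_Ioi hδ, ENNReal.ofReal_add (by positivity) (by positivity), add_mul]
    exact add_le_add hlow hhigh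

theorem exists_lintegral_rpow_neg_mul_le (hloc : IsScaleDensity πloc) {M : ℝ≥0}
    (hM : ∀ l, 0 < l → πloc l ≤ M) {α : ℝ} (hα0 : 0 < α) (hα1 : α < 1) {ε : ℝ} (hε : 0 < ε) :
    ∃ K : ℝ, 0 ≤ K ∧ ∀ s, 0 < s →
      ∫⁻ l in Ioi 0, ENNReal.ofReal l ^ (-α) * (scaleFactor s 1 l * πloc l)
        ≤ ENNReal.ofReal (ε * s ^ (-α) + K) * ∫⁻ l in Ioi 0, scaleFactor s 1 l * πloc l := by
  obtain ⟨s₀, K, hs₀, hK, h⟩ := exists_lintegral_rpow_neg_mul_le_near_zero hloc hM hα0 hα1 hε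
  have hs₀α : 0 < s₀ ^ (-α) := Real.rpow_pos_of_pos hs₀ _
  refine ⟨ε * s₀ ^ (-α) + K, by positivity, fun s hs => ?_⟩
  have hsα : 0 < s ^ (-α) := Real.rpow_pos_of_pos hs _
  rcases le_total s s₀ with hss | hss
  · refine (h s hs hss).trans ?_
    have : 0 < ε * s₀ ^ (-α) := by positivity
    exact mul_le_mul_left (ENNReal.ofReal_le_ofReal (by linarith)) _
  · refine (lintegral_rpow_neg_mul_le_of_le hloc hα0 hs₀ hss (by positivity)
      (h s₀ hs₀ le_rfl)).trans ?_
    have : 0 < ε * s ^ (-α) := by positivity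
    exact mul_le_mul_left (ENNReal.ofReal_le_ofReal (by linarith)) _

theorem lintegral_div_lintegral_le_one {A : Type*} [MeasurableSpace A] {μ : Measure A}
    {f : A → ℝ≥0∞} (hf : Measurable f) : ∫⁻ a, f a / ∫⁻ a, f a ∂μ ∂μ ≤ 1 := by
  simp only [div_eq_mul_inv]
  rw [lintegral_mul_const _ hf]
  exact ENNReal.mul_inv_le_one _

theorem lintegral_localDensity_le_one (hloc : IsScaleDensity πloc) (b τ : ℝ) :
    ∫⁻ l, localDensity πloc b τ l ≤ 1 := by
  have hπ := hloc.measurable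
  have hm : Measurable fun l => scaleFactor b τ l * (πloc l : ℝ≥0∞) :=
    (measurable_scaleFactor_comp measurable_const measurable_const measurable_id).mul (by fun_prop)
  unfold localDensity
  rw [lintegral_indicator measurableSet_Ioi]
  exact lintegral_div_lintegral_le_one hm

theorem lintegral_globalDensity_le_one {p : ℕ} {πglo : ℝ → ℝ≥0} (hglo : Measurable πglo)
    (β l : Fin p → ℝ) : ∫⁻ τ, globalDensity πglo β l τ ≤ 1 := by
  have hs : ∀ j, Measurable fun τ => scaleFactor (β j) τ (l j) := fun j =>
    measurable_scaleFactor_comp measurable_const measurable_id measurable_const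
  unfold globalDensity
  rw [lintegral_indicator measurableSet_Ioi]
  exact lintegral_div_lintegral_le_one (by fun_prop)

/-- The conditional law of the local scale depends on `(b, τ)` only through `|b| / τ`. -/
theorem localDensity_eq (b : ℝ) {τ : ℝ} (hτ : 0 < τ) {l : ℝ} (hl : 0 < l) :
    localDensity πloc b τ l = scaleFactor (|b| / τ) 1 l * πloc l
      / ∫⁻ u in Ioi 0, scaleFactor (|b| / τ) 1 u * πloc u := by
  have h : ∀ u, scaleFactor b τ u = ENNReal.ofReal τ⁻¹ * scaleFactor (|b| / τ) 1 u := by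
    intro u
    rw [scaleFactor_one, scaleFactor, ← ENNReal.ofReal_mul (by positivity), mul_inv, mul_assoc,
      div_pow, sq_abs]
    congr 4
    field_simp
  have h0 : ENNReal.ofReal τ⁻¹ ≠ 0 := by simpa using hτ
  rw [localDensity, indicator_of_mem (mem_Ioi.2 hl)]
  simp only [h, mul_assoc]
  rw [lintegral_const_mul' _ _ ENNReal.ofReal_ne_top,
    ENNReal.mul_div_mul_left _ _ h0 ENNReal.ofReal_ne_top]

/-- The drift of the scales: as `τ` is bounded below, the conditional mean of `(τ λ_j) ^ (-α)` is
at most an arbitrarily small multiple of `|b| ^ (-α)` plus a constant. -/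
theorem exists_lintegral_localDensity_le (hloc : IsScaleDensity πloc) {M : ℝ≥0}
    (hM : ∀ l, 0 < l → πloc l ≤ M) {τmin : ℝ} (hτmin : 0 < τmin) {α : ℝ} (hα0 : 0 ≤ α)
    (hα1 : α < 1) {ε : ℝ} (hε : 0 < ε) :
    ∃ K : ℝ≥0, ∀ b τ, τmin ≤ τ →
      ∫⁻ l, ENNReal.ofReal (τ * l) ^ (-α) * localDensity πloc b τ l
        ≤ ENNReal.ofReal ε * ENNReal.ofReal |b| ^ (-α) + K := by
  have hπ := hloc.measurable
  rcases hα0.eq_or_lt with rfl | hα0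
  · refine ⟨1, fun b τ _ => le_add_left ?_⟩
    simpa using lintegral_localDensity_le_one hloc b τ
  obtain ⟨K, hK0, hK⟩ := exists_lintegral_rpow_neg_mul_le hloc hM hα0 hα1 hε
  refine ⟨Real.toNNReal (τmin ^ (-α) * K), fun b τ hτ => ?_⟩
  rcases eq_or_ne b 0 with rfl | hb
  · have : ENNReal.ofReal ε * ENNReal.ofReal |(0 : ℝ)| ^ (-α) = ∞ := by
      rw [abs_zero, ENNReal.ofReal_zero, ENNReal.zero_rpow_of_neg (by linarith),
        ENNReal.mul_top (by simpa using hε)]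
    rw [this, top_add]
    exact le_top
  have hτ0 : 0 < τ := hτmin.trans_le hτ
  have hs : 0 < |b| / τ := by positivity
  have hm := measurable_scaleFactor_one (|b| / τ)
  set D := ∫⁻ u in Ioi 0, scaleFactor (|b| / τ) 1 u * πloc u with hD
  have hle : ∀ l, ENNReal.ofReal (τ * l) ^ (-α) * localDensity πloc b τ l
      = (Ioi (0 : ℝ)).indicator (fun l => ENNReal.ofReal (τ ^ (-α)) *
        (ENNReal.ofReal l ^ (-α) * (scaleFactor (|b| / τ) 1 l * πloc l)) / D) l := by
    intro l
    by_cases hl : 0 < l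
    · rw [indicator_of_mem (mem_Ioi.2 hl), localDensity_eq b hτ0 hl,
        ENNReal.ofReal_rpow_of_pos (by positivity), Real.mul_rpow hτ0.le hl.le,
        ENNReal.ofReal_mul (by positivity), ENNReal.ofReal_rpow_of_pos hl, ← hD]
      simp only [div_eq_mul_inv]
      ring
    · simp [localDensity, hl]
  simp only [hle]
  rw [lintegral_indicator measurableSet_Ioi]
  simp only [div_eq_mul_inv]
  rw [lintegral_mul_const _ (by fun_prop), lintegral_const_mul _ (by fun_prop), ← div_eq_mul_inv]
  have hbα : 0 < |b| ^ (-α) := by positivity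
  have hτα : 0 < τ ^ (-α) := by positivity
  refine ENNReal.div_le_of_le_mul ?_
  calc _ ≤ ENNReal.ofReal (τ ^ (-α)) * (ENNReal.ofReal (ε * (|b| / τ) ^ (-α) + K) * D) := by
        gcongr
        exact hK _ hs
    _ = ENNReal.ofReal (ε * |b| ^ (-α) + τ ^ (-α) * K) * D := by
        rw [← mul_assoc, ← ENNReal.ofReal_mul hτα.le]
        congr 2
        rw [Real.div_rpow (abs_nonneg b) hτ0.le]
        field_simp
    _ ≤ _ := by
        gcongr
        rw [ENNReal.ofReal_add (by positivity) (by positivity), ENNReal.ofReal_mul hε.le,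
          ENNReal.ofReal_rpow_of_pos (by positivity)]
        gcongr
        exact ENNReal.ofReal_le_ofReal (mul_le_mul_of_nonneg_right
          (Real.rpow_le_rpow_of_nonpos hτmin hτ (by linarith)) hK0)

/-! ### The drift condition -/

variable {n p : ℕ}

/-- The joint integral over the local scales factors, and all factors but the `j`-th are at
most one. -/
theorem lintegral_prod_localDensity_mul_le (hloc : IsScaleDensity πloc)
    (b : Fin p → ℝ) (τ : ℝ) (j : Fin p) {h : ℝ → ℝ≥0∞} (hh : Measurable h) :
    ∫⁻ l : Fin p → ℝ, (∏ i, localDensity πloc (b i) τ (l i)) * h (l j)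
      ≤ ∫⁻ t, localDensity πloc (b j) τ t * h t := by
  have hm : ∀ i, Measurable fun t => localDensity πloc (b i) τ t := fun i =>
    measurable_localDensity_comp hloc.measurable (b i) measurable_const measurable_id
  have heq : ∀ l : Fin p → ℝ, (∏ i, localDensity πloc (b i) τ (l i)) * h (l j)
      = ∏ i, localDensity πloc (b i) τ (l i) * (if i = j then h (l i) else 1) := by
    intro l
    rw [Finset.prod_mul_distrib]
    simp
  simp only [heq]
  rw [lintegral_pi_prod
    (f := fun i t => localDensity πloc (b i) τ t * (if i = j then h t else 1))]
  · calc _ ≤ ∏ i, if i = j then ∫⁻ t, localDensity πloc (b j) τ t * h t else 1 := by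
          refine Finset.prod_le_prod' fun i _ => ?_
          by_cases hi : i = j
          · subst hi; simp
          · simpa [hi] using lintegral_localDensity_le_one hloc (b i) τ
      _ = _ := by simp
  · intro i
    by_cases hi : i = j
    · subst hi
      simp only [if_true]
      exact (hm i).mul hh
    · simpa [hi] using hm i

variable (X : Matrix (Fin n) (Fin p) ℝ) (y : Fin n → ℝ) (ζ : ℝ) {πglo : ℝ → ℝ≥0}

theorem measurable_kernelIntegrand_comp (hloc : Measurable πloc) (hglo : Measurable πglo)
    (θs : (Fin p → ℝ) × (Fin p → ℝ)) {A : Type*} [MeasurableSpace A] {τ : A → ℝ}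
    {l β : A → Fin p → ℝ} (hτ : Measurable τ) (hl : Measurable l) (hβ : Measurable β) :
    Measurable fun a => coefKernel X y ζ θs.1 (τ a) (l a) (β a) *
      (∏ i, localDensity πloc (θs.1 i) (τ a) (l a i)) * globalDensity πglo θs.1 θs.2 (τ a) := by
  refine ((measurable_coefKernel_comp X y ζ θs.1 hτ hl hβ).mul
    (Finset.measurable_prod _ fun i _ => ?_)).mul ((measurable_globalDensity hglo _ _).comp hτ)
  exact measurable_localDensity_comp hloc _ hτ ((measurable_pi_apply i).comp hl)

theorem measurable_marginalKernel (hloc : Measurable πloc) (hglo : Measurable πglo)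
    (θs : (Fin p → ℝ) × (Fin p → ℝ)) : Measurable (marginalKernel X y ζ πloc πglo θs) :=
  Measurable.lintegral_prod_right' (f := fun q : ((Fin p → ℝ) × (Fin p → ℝ)) × ℝ =>
    coefKernel X y ζ θs.1 q.2 q.1.2 q.1.1 * (∏ j, localDensity πloc (θs.1 j) q.2 (q.1.2 j))
      * globalDensity πglo θs.1 θs.2 q.2)
    (measurable_kernelIntegrand_comp X y ζ hloc hglo θs measurable_snd
      (measurable_snd.comp measurable_fst) (measurable_fst.comp measurable_fst))

variable {ζ}

/-- One coordinate of the drift condition. The singular term of the bound for `β j` given the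
scales is averaged over the new local scale, where it costs only a small multiple of
`|β*_j| ^ (-α)`. -/
theorem exists_lintegral_marginalKernel_le (hζ : 0 < ζ) (hloc : IsScaleDensity πloc)
    (hglo : IsScaleDensity πglo) {M : ℝ≥0} (hM : ∀ l, 0 < l → πloc l ≤ M) {τmin : ℝ}
    (hτmin : 0 < τmin) (hsupp : ∀ τ, 0 < τ → τ < τmin → πglo τ = 0) {α : ℝ} (hα0 : 0 ≤ α)
    (hα1 : α < 1) {ε : ℝ} (hε : 0 < ε) (j : Fin p) :
    ∃ K : ℝ≥0, ∀ θs : (Fin p → ℝ) × (Fin p → ℝ),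
      ∫⁻ θ, ENNReal.ofReal |θ.1 j| ^ (-α) * marginalKernel X y ζ πloc πglo θs θ
        ≤ ENNReal.ofReal (2 / (1 - α) + 1)
          * (ENNReal.ofReal ε * ENNReal.ofReal |θs.1 j| ^ (-α) + K) := by
  obtain ⟨B, hB⟩ := exists_lintegral_coefKernel_le X y hζ hα0 hα1 j
  obtain ⟨K, hK⟩ := exists_lintegral_localDensity_le hloc hM hτmin hα0 hα1 hε
  refine ⟨K + B, fun θs => ?_⟩
  set C := ENNReal.ofReal (2 / (1 - α) + 1)
  set R : ℝ≥0∞ := ENNReal.ofReal ε * ENNReal.ofReal |θs.1 j| ^ (-α) + ((K + B : ℝ≥0) : ℝ≥0∞) with hR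
  -- Given `τ ≥ τmin`, integrate over `β` first and over the local scales second.
  have hscale : ∀ τ, τmin ≤ τ →
      ∫⁻ l : Fin p → ℝ, (∫⁻ β : Fin p → ℝ, ENNReal.ofReal |β j| ^ (-α) *
        coefKernel X y ζ θs.1 τ l β) * ∏ i, localDensity πloc (θs.1 i) τ (l i) ≤ C * R := by
    intro τ hτ
    calc _ ≤ ∫⁻ l : Fin p → ℝ, (∏ i, localDensity πloc (θs.1 i) τ (l i))
          * (C * (B + ENNReal.ofReal (τ * l j) ^ (-α))) := by
          refine lintegral_mono fun l => ?_
          simp only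
          by_cases hl : 0 < l j
          · rw [mul_comm]
            gcongr
            exact hB θs.1 τ l (hτmin.trans_le hτ) hl
          · have h0 : localDensity πloc (θs.1 j) τ (l j) = 0 :=
              indicator_of_notMem (by simpa using hl) _
            rw [Finset.prod_eq_zero (Finset.mem_univ j) h0, mul_zero]
            exact zero_le
      _ ≤ ∫⁻ t, localDensity πloc (θs.1 j) τ t * (C * (B + ENNReal.ofReal (τ * t) ^ (-α))) :=
          lintegral_prod_localDensity_mul_le hloc θs.1 τ j
            (h := fun t => C * (B + ENNReal.ofReal (τ * t) ^ (-α))) (by fun_prop)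
      _ = C * (B * (∫⁻ t, localDensity πloc (θs.1 j) τ t)
            + ∫⁻ t, ENNReal.ofReal (τ * t) ^ (-α) * localDensity πloc (θs.1 j) τ t) := by
          have hm : Measurable fun t => localDensity πloc (θs.1 j) τ t :=
            measurable_localDensity_comp hloc.measurable _ measurable_const measurable_id
          rw [← lintegral_const_mul _ hm, ← lintegral_add_left (by fun_prop),
            ← lintegral_const_mul _ (by fun_prop)]
          refine lintegral_congr fun t => ?_
          ring
      _ ≤ C * R := by
          rw [hR, ENNReal.coe_add, ← add_assoc, add_comm ((B : ℝ≥0∞) * _)]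
          gcongr
          · exact hK _ τ hτ
          · exact mul_le_of_le_one_right' (lintegral_localDensity_le_one hloc _ _)
  have hpow {A : Type} [MeasurableSpace A] {β : A → Fin p → ℝ} (hβ : Measurable β) :
      Measurable fun a => ENNReal.ofReal |β a j| ^ (-α) := by fun_prop
  calc ∫⁻ θ, ENNReal.ofReal |θ.1 j| ^ (-α) * marginalKernel X y ζ πloc πglo θs θ
      = ∫⁻ θ : (Fin p → ℝ) × (Fin p → ℝ), ∫⁻ τ in Ioi 0, ENNReal.ofReal |θ.1 j| ^ (-α) *
          (coefKernel X y ζ θs.1 τ θ.2 θ.1 * (∏ i, localDensity πloc (θs.1 i) τ (θ.2 i))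
            * globalDensity πglo θs.1 θs.2 τ) := by
        refine lintegral_congr fun θ => ?_
        have hm := measurable_kernelIntegrand_comp X y ζ hloc.measurable hglo.measurable θs
          measurable_id (measurable_const (a := θ.2)) (measurable_const (a := θ.1))
        simp only [id] at hm
        rw [marginalKernel, lintegral_const_mul _ hm]
    _ = ∫⁻ τ in Ioi 0, (∫⁻ θ : (Fin p → ℝ) × (Fin p → ℝ), ENNReal.ofReal |θ.1 j| ^ (-α) *
          (coefKernel X y ζ θs.1 τ θ.2 θ.1 * (∏ i, localDensity πloc (θs.1 i) τ (θ.2 i))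
            * globalDensity πglo θs.1 θs.2 τ)) := by
        refine lintegral_lintegral_swap (Measurable.aemeasurable ?_)
        exact (hpow (measurable_fst.comp measurable_fst)).mul
          (measurable_kernelIntegrand_comp X y ζ hloc.measurable hglo.measurable θs measurable_snd
          (measurable_snd.comp measurable_fst) (measurable_fst.comp measurable_fst))
    _ = ∫⁻ τ in Ioi 0, globalDensity πglo θs.1 θs.2 τ * ∫⁻ l : Fin p → ℝ,
          (∫⁻ β : Fin p → ℝ, ENNReal.ofReal |β j| ^ (-α) * coefKernel X y ζ θs.1 τ l β)
            * ∏ i, localDensity πloc (θs.1 i) τ (l i) := by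
        refine lintegral_congr fun τ => ?_
        have hm1 : Measurable fun θ : (Fin p → ℝ) × (Fin p → ℝ) =>
            ENNReal.ofReal |θ.1 j| ^ (-α) * coefKernel X y ζ θs.1 τ θ.2 θ.1 :=
          (hpow measurable_fst).mul
            (measurable_coefKernel_comp X y ζ θs.1 measurable_const measurable_snd measurable_fst)
        have hm2 : Measurable fun l : Fin p → ℝ => ∏ i, localDensity πloc (θs.1 i) τ (l i) :=
          Finset.measurable_prod _ fun i _ => measurable_localDensity_comp hloc.measurable _
            measurable_const (measurable_pi_apply i)
        have hm3 : Measurable fun l : Fin p → ℝ =>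
            (∫⁻ β : Fin p → ℝ, ENNReal.ofReal |β j| ^ (-α) * coefKernel X y ζ θs.1 τ l β)
              * ∏ i, localDensity πloc (θs.1 i) τ (l i) := hm1.lintegral_prod_left'.mul hm2
        rw [Measure.volume_eq_prod]
        refine (lintegral_prod_symm _ (Measurable.aemeasurable
          ((hpow measurable_fst).mul (measurable_kernelIntegrand_comp X y ζ hloc.measurable
            hglo.measurable θs measurable_const measurable_snd measurable_fst)))).trans ?_
        rw [← lintegral_const_mul _ hm3]
        refine lintegral_congr fun l => ?_
        have hm4 : Measurable fun β : Fin p → ℝ =>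
            ENNReal.ofReal |β j| ^ (-α) * coefKernel X y ζ θs.1 τ l β :=
          hm1.comp (measurable_id.prodMk measurable_const)
        rw [mul_comm (lintegral _ _), ← mul_assoc, ← lintegral_const_mul _ hm4]
        refine lintegral_congr fun β => ?_
        simp only [Pi.mul_apply]
        ring
    _ ≤ ∫⁻ τ in Ioi 0, globalDensity πglo θs.1 θs.2 τ * (C * R) := by
        refine setLIntegral_mono
          ((measurable_globalDensity hglo.measurable _ _).mul_const _) fun τ hτ => ?_
        rcases le_or_gt τmin τ with h | h
        · gcongr
          exact hscale τ h
        · have : globalDensity πglo θs.1 θs.2 τ = 0 := by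
            rw [globalDensity, indicator_of_mem hτ, hsupp τ hτ h]
            simp
          simp [this]
    _ ≤ (∫⁻ τ, globalDensity πglo θs.1 θs.2 τ) * (C * R) := by
        rw [lintegral_mul_const _ (measurable_globalDensity hglo.measurable _ _)]
        exact mul_le_mul_left (setLIntegral_le_lintegral _ _) _
    _ ≤ C * R := mul_le_of_le_one_left' (lintegral_globalDensity_le_one hglo.measurable _ _)

end SparseLogit

theorem mainTheorem5 {n p : ℕ} (X : Matrix (Fin n) (Fin p) ℝ) (y : Fin n → ℝ)
    (hy : ∀ i, y i = 0 ∨ y i = 1) (ζ : ℝ) (hζ : 0 < ζ)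
    (πloc πglo : ℝ → ℝ≥0) (hloc : SparseLogit.IsScaleDensity πloc)
    (hglo : SparseLogit.IsScaleDensity πglo)
    (hbdd : ∃ M : ℝ≥0, ∀ l, 0 < l → πloc l ≤ M)
    (τmin : ℝ) (hτmin : 0 < τmin) (hsupp : ∀ τ, 0 < τ → τ < τmin → πglo τ = 0)
    (α : ℝ) (hα0 : 0 ≤ α) (hα1 : α < 1) :
    SparseLogit.DriftCondition (volume : Measure ((Fin p → ℝ) × (Fin p → ℝ)))
      {θ | ∀ j, 0 < θ.2 j}
      (SparseLogit.marginalKernel X y ζ πloc πglo)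
      (fun θ => SparseLogit.lyapunov α θ.1) := by
  obtain ⟨M, hM⟩ := hbdd
  have h1α : 0 < 1 - α := by linarith
  -- `c` is the Gaussian moment constant; taking `ε = 1 / (2 c)` makes the contraction rate `1 / 2`.
  -- The rate must be positive: for `α > 0`, `γ * V = ∞` is used at states with a
  -- vanishing coefficient.
  set c : ℝ := 2 / (1 - α) + 1 with hc
  have hc0 : 0 < c := by positivity
  have hcε : ENNReal.ofReal c * ENNReal.ofReal (1 / (2 * c)) = ((1 / 2 : ℝ≥0) : ℝ≥0∞) := by
    rw [← ENNReal.ofReal_mul hc0.le, ENNReal.ofReal]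
    congr 1
    ext
    rw [Real.coe_toNNReal _ (by positivity)]
    push_cast
    field_simp
  choose K hK using fun j => SparseLogit.exists_lintegral_marginalKernel_le X y hζ hloc hglo hM
    hτmin hsupp hα0 hα1 (ε := 1 / (2 * c)) (by positivity) j
  have hmk := SparseLogit.measurable_marginalKernel X y ζ hloc.measurable hglo.measurable
  refine ⟨1 / 2, ∑ j, Real.toNNReal c * K j, by
    rw [div_lt_one two_pos]; exact one_lt_two, fun θs _ => ?_⟩
  refine (setLIntegral_le_lintegral _ _).trans ?_
  simp only [SparseLogit.lyapunov, Finset.sum_mul, Finset.mul_sum]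
  have hsum (j : Fin p) : Measurable fun θ : (Fin p → ℝ) × (Fin p → ℝ) =>
      ENNReal.ofReal |θ.1 j| ^ (-α) * SparseLogit.marginalKernel X y ζ πloc πglo θs θ :=
    Measurable.mul (by fun_prop) (hmk θs)
  rw [lintegral_finsetSum _ fun j _ => hsum j,
    ENNReal.ofNNReal_finsetSum, ← Finset.sum_add_distrib]
  refine Finset.sum_le_sum fun j _ => (hK j θs).trans (le_of_eq ?_)
  rw [← hc, mul_add, ← mul_assoc, hcε, ENNReal.coe_mul]
  rfl
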